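/- Let $\mathbb K$ be an algebraically closed field of characteristic $0$ and let $n, r, c \ge 0$ be integers. A linear monad on $\mathbb P^n=\mathbb P^n_{\mathbb K}$ (with parameters $r,c$) is a sequence of morphisms of sheaves of $\mathcal O_{\mathbb P^n}$-modules $$\mathcal O(-1)^{\oplus c} \xrightarrow{\ \alpha\ } \mathcal O^{\oplus r+2c} \xrightarrow{\ \beta\ } \mathcal O(1)^{\oplus c}$$ with $\beta\circ\alpha = 0$, $\alpha$ injective and $\beta$ surjective as sheaf maps; its cohomology is the sheaf $\ker\beta/\operatorname{im}\alpha$. An instanton bundle of rank $r$ and charge $c$ on $\mathbb P^n$ is a locally free sheaf (of finite rank) isomorphic to the cohomology of such a linear monad. Let $\mathcal E$ be an instanton bundle of rank $r$ and charge $c$ on $\mathbb P^n$, and write $\mathcal E^\vee=\mathcal Hom(\mathcal E,\mathcal O)$. Then for every linear monad $(\alpha,\beta)$ with parameters $r,c$ whose cohomology is isomorphic to $\mathcal E$, the dual sequence $$\mathcal O(-1)^{\oplus c} \xrightarrow{\ \beta^\vee\ } \mathcal O^{\oplus r+2c} \xrightarrow{\ \alpha^\vee\ } \mathcal O(1)^{\oplus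 c},$$ obtained by identifying $(\mathcal O(1)^{\oplus c})^\vee$, $(\mathcal O^{\oplus r+2c})^\vee$ and $(\mathcal O(-1)^{\oplus c})^\vee$ with $\mathcal O(-1)^{\oplus c}$, $\mathcal O^{\oplus r+2c}$ and $\mathcal O(1)^{\oplus c}$ through the canonical isomorphisms, is again a linear monad, and its cohomology is isomorphic to $\mathcal E^\vee$. In particular, $\mathcal E^\vee$ is again an instanton bundle of rank $r$ and charge $c$. -/

import Mathlib

open CategoryTheory CategoryTheory.Limits TopologicalSpace Opposite AlgebraicGeometry
universe u

namespace Instanton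
noncomputable section
section Dual
variable {X : Scheme.{u}}

/-- The sections over `U` of the dual `ℋom(M, 𝒪_X)`: the `𝒪_U`-linear morphisms `M|_U ⟶ 𝒪_U`, that
is, families of `Γ(X, V)`-linear maps `φ_V : Γ(M, V) → Γ(X, V)` for the open `V ≤ U`, compatible with
restriction. -/
def dualSections (M : X.Modules) (U : X.Opens) :
    AddSubgroup ((V : {V : X.Opens // V ≤ U}) → (Γ(M, V.1) →ₗ[Γ(X, V.1)] Γ(X, V.1))) where
  carrier := {φ | ∀ (V W : {V : X.Opens // V ≤ U}) (h : W.1 ≤ V.1) (m : Γ(M, V.1)),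
    X.presheaf.map (homOfLE h).op (φ V m) = φ W (M.presheaf.map (homOfLE h).op m)}
  zero_mem' := by intro V W h m; simp
  add_mem' := by
    intro φ ψ hφ hψ V W h m
    simp [hφ V W h m, hψ V W h m]
  neg_mem' := by
    intro φ hφ V W h m
    simp [hφ V W h m]

theorem res_res {U V W : X.Opens} (h : W ≤ V) (h' : V ≤ U) (r : Γ(X, U)) :
    X.presheaf.map (homOfLE h).op (X.presheaf.map (homOfLE h').op r) =
      X.presheaf.map (homOfLE (h.trans h')).op r := by
  rw [← ConcreteCategory.comp_apply, ← X.presheaf.map_comp]; rfl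

theorem mres_res (M : X.Modules) {U V W : X.Opens} (h : W ≤ V) (h' : V ≤ U) (r : Γ(M, U)) :
    M.presheaf.map (homOfLE h).op (M.presheaf.map (homOfLE h').op r) =
      M.presheaf.map (homOfLE (h.trans h')).op r := by
  rw [← ConcreteCategory.comp_apply, ← M.presheaf.map_comp]; rfl

/-- A section `r` of the structure sheaf over `U` acts on `φ` by `(r φ)_V = r|_V φ_V`. -/
instance (M : X.Modules) (U : X.Opens) : SMul Γ(X, U) (dualSections M U) where
  smul r φ := ⟨fun V => X.presheaf.map (homOfLE V.2).op r • φ.1 V, by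
    intro V W h m
    simp only [LinearMap.smul_apply, smul_eq_mul, map_mul, res_res, φ.2 V W h m]⟩

theorem dualSections_smul_apply {M : X.Modules} {U : X.Opens} (r : Γ(X, U))
    (φ : dualSections M U) (V : {V : X.Opens // V ≤ U}) (m : Γ(M, V.1)) :
    (r • φ).1 V m = X.presheaf.map (homOfLE V.2).op r * φ.1 V m := rfl

theorem dualSections_ext {M : X.Modules} {U : X.Opens} {φ ψ : dualSections M U}
    (h : ∀ V m, φ.1 V m = ψ.1 V m) : φ = ψ :=
  Subtype.ext (funext fun V => LinearMap.ext (h V))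

theorem dualSections_add_apply {M : X.Modules} {U : X.Opens}
    (φ ψ : dualSections M U) (V : {V : X.Opens // V ≤ U}) (m : Γ(M, V.1)) :
    (φ + ψ).1 V m = φ.1 V m + ψ.1 V m := rfl

theorem dualSections_zero_apply {M : X.Modules} {U : X.Opens}
    (V : {V : X.Opens // V ≤ U}) (m : Γ(M, V.1)) :
    (0 : dualSections M U).1 V m = 0 := rfl

instance (M : X.Modules) (U : X.Opens) : Module Γ(X, U) (dualSections M U) where
  one_smul φ := dualSections_ext fun V m => by simp [dualSections_smul_apply]
  mul_smul r s φ := dualSections_ext fun V m => by simp [dualSections_smul_apply, mul_assoc]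
  smul_zero r := dualSections_ext fun V m => by
    simp [dualSections_smul_apply]
  smul_add r φ ψ := dualSections_ext fun V m => by
    simp only [dualSections_smul_apply, dualSections_add_apply, mul_add]
  add_smul r s φ := dualSections_ext fun V m => by
    simp only [dualSections_smul_apply, dualSections_add_apply, map_add, add_mul]
  zero_smul φ := dualSections_ext fun V m => by
    simp only [dualSections_smul_apply, dualSections_zero_apply, map_zero, zero_mul]

/-- Restriction of sections of the dual. -/
def dualRes (M : X.Modules) {U V : X.Opens} (h : V ≤ U) : dualSections M U →+ dualSections M V where
  toFun φ := ⟨fun W => φ.1 ⟨W.1, W.2.trans h⟩, fun W W' hW m =>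
    φ.2 ⟨W.1, W.2.trans h⟩ ⟨W'.1, W'.2.trans h⟩ hW m⟩
  map_zero' := rfl
  map_add' _ _ := rfl

/-- The presheaf of abelian groups underlying the dual. -/
def dualPresheafAb (M : X.Modules) : TopCat.Presheaf Ab X where
  obj U := AddCommGrpCat.of (dualSections M U.unop)
  map i := AddCommGrpCat.ofHom (dualRes M i.unop.le)

instance (M : X.Modules) (U : X.Opensᵒᵖ) :
    Module (X.ringCatSheaf.obj.obj U) ((dualPresheafAb M).obj U) :=
  inferInstanceAs (Module Γ(X, U.unop) (dualSections M U.unop))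

theorem dualPresheafAb_isSheaf (M : X.Modules) : (dualPresheafAb M).IsSheaf := by
  rw [TopCat.Presheaf.isSheaf_iff_isSheafUniqueGluing]
  intro ι U f hf
  -- compatibility
  have hc : ∀ (i j : ι) (V : X.Opens) (hi : V ≤ U i) (hj : V ≤ U j) (m : Γ(M, V)),
      (f i : dualSections M (U i)).1 ⟨V, hi⟩ m = (f j : dualSections M (U j)).1 ⟨V, hj⟩ m := by
    intro i j V hi hj m
    have := hf i j
    have h2 := congrArg (fun φ : dualSections M (U i ⊓ U j) => φ.1 ⟨V, le_inf hi hj⟩ m) this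
    exact h2
  have hV : ∀ V : {V : X.Opens // V ≤ iSup U}, V.1 ≤ iSup fun i => V.1 ⊓ U i := fun V => by
    rw [← inf_iSup_eq]; exact le_inf le_rfl V.2
  have key : ∀ (V : {V : X.Opens // V ≤ iSup U}) (m : Γ(M, V.1)), ∃! s : Γ(X, V.1), ∀ i,
      X.presheaf.map (homOfLE (inf_le_left : V.1 ⊓ U i ≤ V.1)).op s =
        (f i : dualSections M (U i)).1 ⟨V.1 ⊓ U i, inf_le_right⟩
          (M.presheaf.map (homOfLE (inf_le_left : V.1 ⊓ U i ≤ V.1)).op m) := by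
    intro V m
    refine X.sheaf.existsUnique_gluing' (fun i => V.1 ⊓ U i) V.1
      (fun i => homOfLE inf_le_left) (hV V)
      (fun i => (f i : dualSections M (U i)).1 ⟨V.1 ⊓ U i, inf_le_right⟩
          (M.presheaf.map (homOfLE (inf_le_left : V.1 ⊓ U i ≤ V.1)).op m)) ?_
    intro i j
    have h1 := (f i : dualSections M (U i)).2 ⟨V.1 ⊓ U i, inf_le_right⟩
      ⟨(V.1 ⊓ U i) ⊓ (V.1 ⊓ U j), inf_le_left.trans inf_le_right⟩ inf_le_left
      (M.presheaf.map (homOfLE (inf_le_left : V.1 ⊓ U i ≤ V.1)).op m)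
    have h2 := (f j : dualSections M (U j)).2 ⟨V.1 ⊓ U j, inf_le_right⟩
      ⟨(V.1 ⊓ U i) ⊓ (V.1 ⊓ U j), inf_le_right.trans inf_le_right⟩ inf_le_right
      (M.presheaf.map (homOfLE (inf_le_left : V.1 ⊓ U j ≤ V.1)).op m)
    rw [mres_res] at h1 h2
    exact h1.trans ((hc i j _ _ _ _).trans h2.symm)
  choose g hg hgu using key
  have huniq : ∀ (V : {V : X.Opens // V ≤ iSup U}) (s t : Γ(X, V.1)),
      (∀ i, X.presheaf.map (homOfLE (inf_le_left : V.1 ⊓ U i ≤ V.1)).op s =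
        X.presheaf.map (homOfLE (inf_le_left : V.1 ⊓ U i ≤ V.1)).op t) → s = t := fun V s t h =>
    X.sheaf.eq_of_locally_eq' (fun i => V.1 ⊓ U i) V.1 (fun i => homOfLE inf_le_left) (hV V) s t h
  refine ⟨(⟨fun V => ⟨⟨g V, ?_⟩, ?_⟩, ?_⟩ : dualSections M (iSup U)), ?_, ?_⟩
  · intro m m'
    refine huniq V _ _ fun i => ?_
    simp only [map_add, hg]
  · intro r m
    refine huniq V _ _ fun i => ?_
    simp only [hg, smul_eq_mul, map_mul, RingHom.id_apply, Scheme.Modules.map_smul, map_smul]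
  · intro V W h m
    refine huniq W _ _ fun i => ?_
    have h1 := (f i : dualSections M (U i)).2 ⟨V.1 ⊓ U i, inf_le_right⟩
      ⟨W.1 ⊓ U i, inf_le_right⟩ (inf_le_inf_right _ h)
      (M.presheaf.map (homOfLE (inf_le_left : V.1 ⊓ U i ≤ V.1)).op m)
    rw [← hg, res_res, mres_res] at h1
    refine (res_res _ _ _).trans (h1.trans ?_)
    refine Eq.trans ?_ (hg W _ i).symm
    rw [mres_res]
  · intro i
    refine dualSections_ext fun V m => ?_
    have hle : V.1 ≤ iSup U := V.2.trans (le_iSup U i)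
    refine huniq ⟨V.1, hle⟩ _ _ fun j => ?_
    refine (hg ⟨V.1, hle⟩ m j).trans ?_
    refine (hc j i _ _ (inf_le_left.trans V.2) _).trans ?_
    exact ((f i : dualSections M (U i)).2 V ⟨V.1 ⊓ U j, inf_le_left.trans V.2⟩ inf_le_left m).symm
  · intro ψ hψ
    refine dualSections_ext fun V m => ?_
    refine hgu V m _ fun i => ?_
    refine ((ψ : dualSections M (iSup U)).2 V ⟨V.1 ⊓ U i, inf_le_left.trans V.2⟩
      inf_le_left m).trans ?_
    have := hψ i
    exact congrArg (fun φ : dualSections M (U i) => φ.1 ⟨V.1 ⊓ U i, inf_le_right⟩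
      (M.presheaf.map (homOfLE (inf_le_left : V.1 ⊓ U i ≤ V.1)).op m)) this

/-- The dual sheaf `M^∨ = ℋom(M, 𝒪_X)`. -/
def dual (M : X.Modules) : X.Modules where
  val := PresheafOfModules.ofPresheaf (dualPresheafAb M) (by
    intro U V i r φ
    refine dualSections_ext fun W m => ?_
    refine congrArg (fun t : Γ(X, W.1) => t * φ.1 ⟨W.1, W.2.trans i.unop.le⟩ m) ?_
    exact (res_res W.2 i.unop.le r).symm)
  isSheaf := dualPresheafAb_isSheaf M

/-- The dual `f^∨ : N^∨ ⟶ M^∨` of a morphism `f : M ⟶ N`, sending `φ` to `φ ∘ f`. -/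
def dualMap {M N : X.Modules} (f : M ⟶ N) : dual N ⟶ dual M where
  val := PresheafOfModules.homMk
    { app U := AddCommGrpCat.ofHom
        { toFun := fun (φ : dualSections N U.unop) =>
            (⟨fun V => φ.1 V ∘ₗ
                { toFun := f.app V.1
                  map_add' := map_add _
                  map_smul' := Scheme.Modules.Hom.app_smul f }, by
              intro V W h m
              refine (φ.2 V W h _).trans (congrArg (φ.1 W) ?_)
              exact (ConcreteCategory.congr_hom (f.mapPresheaf.naturality (homOfLE h).op) m).symm⟩ :
                dualSections M U.unop)
          map_zero' := rfl
          map_add' := fun _ _ => rfl }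
      naturality := fun _ _ _ => rfl }
    (fun _ _ _ => rfl)

theorem dualMap_comp {M N P : X.Modules} (f : M ⟶ N) (g : N ⟶ P) :
    dualMap (f ≫ g) = dualMap g ≫ dualMap f := rfl

theorem dualMap_zero (M N : X.Modules) : dualMap (0 : M ⟶ N) = 0 := by
  apply Scheme.Modules.hom_ext
  intro U
  ext φ
  exact dualSections_ext fun V m => map_zero (φ.1 V)

/-- The structure sheaf `𝒪_X`, as a module over itself. -/
abbrev structureModule (X : Scheme.{u}) : X.Modules := SheafOfModules.unit X.ringCatSheaf

/-- The canonical morphism `𝒪_X ⟶ 𝒪_X^∨`, sending `s` to `t ↦ s * t`. -/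
def unitToDual (X : Scheme.{u}) : structureModule X ⟶ dual (structureModule X) where
  val := PresheafOfModules.homMk
    { app U := AddCommGrpCat.ofHom
        { toFun := fun (s : Γ(X, U.unop)) =>
            (⟨fun V =>
                { toFun := fun (t : Γ(X, V.1)) => X.presheaf.map (homOfLE V.2).op s * t
                  map_add' := fun t t' => mul_add (R := Γ(X, V.1)) _ t t'
                  map_smul' := fun r t => mul_left_comm (G := Γ(X, V.1)) _ r t }, by
              intro V W h (m : Γ(X, V.1))
              refine (map_mul (X.presheaf.map (homOfLE h).op).hom _ _).trans ?_
              exact congrArg (fun a : Γ(X, W.1) => a * X.presheaf.map (homOfLE h).op m)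
                (res_res h V.2 s)⟩ : dualSections (structureModule X) U.unop)
          map_zero' := dualSections_ext fun V (t : Γ(X, V.1)) => by
            refine (congrArg (fun a : Γ(X, V.1) => a * t) (map_zero _)).trans (zero_mul t)
          map_add' := fun s s' => dualSections_ext fun V (t : Γ(X, V.1)) => by
            refine (congrArg (fun a : Γ(X, V.1) => a * t) (map_add _ s s')).trans (add_mul _ _ t) }
      naturality := fun U U' i => by
        ext (s : Γ(X, U.unop))
        refine dualSections_ext fun V (t : Γ(X, V.1)) => ?_
        exact congrArg (fun a : Γ(X, V.1) => a * t) (res_res V.2 i.unop.le s) }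
    (fun U (r : Γ(X, U.unop)) (s : Γ(X, U.unop)) => dualSections_ext fun V (t : Γ(X, V.1)) => by
      refine (congrArg (fun a : Γ(X, V.1) => a * t) (map_mul _ r s)).trans (mul_assoc _ _ t))

end Dual
section Twist
variable {A : Type u} {σ : Type*} [CommRing A] [SetLike σ A] [AddSubgroupClass σ A]
variable (𝒜 : ℕ → σ) [GradedRing 𝒜]

/-- The localization of `A` at the homogeneous prime `x`. -/
abbrev LocAt (x : ProjectiveSpectrum 𝒜) : Type u :=
  Localization x.asHomogeneousIdeal.toIdeal.primeCompl

/-- The degree-zero part of the localization of `A` at the homogeneous prime `x`. -/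
abbrev HLocAt (x : ProjectiveSpectrum 𝒜) : Type u :=
  HomogeneousLocalization 𝒜 x.asHomogeneousIdeal.toIdeal.primeCompl

/-- `f` is given on `U` by a single fraction `a / b` of homogeneous elements with
`deg a - deg b = d`. -/
def IsFractionOfDegree (d : ℤ) {U : Opens (ProjectiveSpectrum 𝒜)}
    (f : (x : U) → LocAt 𝒜 x.1) : Prop :=
  ∃ (i j : ℕ) (a b : A) (hb : ∀ x : U, b ∉ x.1.asHomogeneousIdeal),
    a ∈ 𝒜 i ∧ b ∈ 𝒜 j ∧ (i : ℤ) = j + d ∧ ∀ x : U, f x = Localization.mk a ⟨b, hb x⟩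

/-- `IsFractionOfDegree` as a prelocal predicate. -/
def isFractionPrelocal (d : ℤ) :
    TopCat.PrelocalPredicate (X := ProjectiveSpectrum.top 𝒜) fun x => LocAt 𝒜 x where
  pred {U} f := IsFractionOfDegree 𝒜 d (U := U) f
  res := by
    rintro V U i f ⟨k, l, a, b, hb, ha, hb', hkl, h⟩
    exact ⟨k, l, a, b, fun x => hb (i x), ha, hb', hkl, fun x => h (i x)⟩

/-- Being locally a fraction of homogeneous elements with difference of degrees `d`. -/
def isLocallyFraction (d : ℤ) :
    TopCat.LocalPredicate (X := ProjectiveSpectrum.top 𝒜) fun x => LocAt 𝒜 x :=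
  (isFractionPrelocal 𝒜 d).sheafify

variable {𝒜} in
theorem isLocallyFraction_val {U : (Proj 𝒜).Opens} (r : Γ(Proj 𝒜, U)) :
    (isLocallyFraction 𝒜 0).pred (U := U) fun x => (r.1 x).val := by
  intro x
  obtain ⟨V, hx, i, k, ⟨a, ha⟩, ⟨b, hb⟩, hn, h⟩ := r.2 x
  refine ⟨V, hx, i, k, k, a, b, fun y => hn y, ha, hb, by simp, fun y => ?_⟩
  exact (congrArg HomogeneousLocalization.val (h y)).trans
    (HomogeneousLocalization.val_mk _)

variable {𝒜} in
theorem isLocallyFraction_mul {d e d' : ℤ} (h : d + e = d')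
    {U : Opens (ProjectiveSpectrum.top 𝒜)} {f g : (x : U) → LocAt 𝒜 x.1}
    (hf : (isLocallyFraction 𝒜 d).pred f) (hg : (isLocallyFraction 𝒜 e).pred g) :
    (isLocallyFraction 𝒜 d').pred fun x => f x * g x := by
  intro x
  obtain ⟨V, hV, ι, i, j, a, b, hb, ha, hb', hij, h1⟩ := hf x
  obtain ⟨W, hW, κ, k, l, a', b', hb2, ha2, hb2', hkl, h2⟩ := hg x
  refine ⟨V ⊓ W, ⟨hV, hW⟩, Opens.infLELeft _ _ ≫ ι, i + k, j + l, a * a', b * b',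
    fun y => (y.1.asHomogeneousIdeal.toIdeal.primeCompl).mul_mem (hb ⟨y.1, y.2.1⟩)
      (hb2 ⟨y.1, y.2.2⟩), SetLike.mul_mem_graded ha ha2, SetLike.mul_mem_graded hb' hb2',
    by push_cast; omega, fun y => ?_⟩
  exact (congrArg₂ (fun s t => s * t) (h1 ⟨y.1, y.2.1⟩) (h2 ⟨y.1, y.2.2⟩)).trans
    (Localization.mk_mul _ _ _ _)

/-- Sections over `U` of `𝒪(d)`: the functions `x ↦ s x` with `s x` in the localization of `A` at
`x`, which are locally fractions of homogeneous elements with difference of degrees `d`. -/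
def twistSections (d : ℤ) (U : (Proj 𝒜).Opens) :
    AddSubgroup ((x : (U : Opens (ProjectiveSpectrum 𝒜))) → LocAt 𝒜 x.1) where
  carrier := {f | (isLocallyFraction 𝒜 d).pred (U := U) f}
  zero_mem' := fun x => by
    classical
    obtain ⟨f, m, hf, hm, hx⟩ : ∃ (f : A) (m : ℕ) (_ : f ∈ 𝒜 m) (_ : 0 < m),
        f ∉ (x.1 : ProjectiveSpectrum 𝒜).asHomogeneousIdeal := by
      by_contra! H
      refine (x.1 : ProjectiveSpectrum 𝒜).not_irrelevant_le fun z hz ↦ ?_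
      rw [← DirectSum.sum_support_decompose 𝒜 z]
      refine Ideal.sum_mem _ fun k hk ↦ H _ k (SetLike.coe_mem _) (Nat.pos_of_ne_zero ?_)
      rintro rfl
      exact DFinsupp.mem_support_iff.mp hk (Subtype.ext hz)
    have hle : d.natAbs ≤ d.natAbs * m := Nat.le_mul_of_pos_right _ hm
    refine ⟨U ⊓ ProjectiveSpectrum.basicOpen 𝒜 f, ⟨x.2, hx⟩, Opens.infLELeft _ _,
      (((d.natAbs * m : ℕ) : ℤ) + d).toNat, d.natAbs * m, 0, f ^ d.natAbs, fun y =>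
        (y.1.asHomogeneousIdeal.toIdeal.primeCompl).pow_mem y.2.2 _, zero_mem _,
        by simpa using SetLike.pow_mem_graded d.natAbs hf,
        by omega, fun y => (Localization.mk_zero _).symm⟩
  add_mem' := by
    intro f g hf hg x
    obtain ⟨V, hV, ι, i, j, a, b, hb, ha, hb', hij, h1⟩ := hf x
    obtain ⟨W, hW, κ, k, l, a', b', hb2, ha2, hb2', hkl, h2⟩ := hg x
    refine ⟨V ⊓ W, ⟨hV, hW⟩, Opens.infLELeft _ _ ≫ ι, i + l, j + l, b' * a + b * a', b * b',
      fun y => (y.1.asHomogeneousIdeal.toIdeal.primeCompl).mul_mem (hb ⟨y.1, y.2.1⟩)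
        (hb2 ⟨y.1, y.2.2⟩), add_mem ?_ ?_, SetLike.mul_mem_graded hb' hb2',
      by push_cast; omega, fun y => ?_⟩
    · rw [add_comm i l]; exact SetLike.mul_mem_graded hb2' ha
    · have : i + l = j + k := by omega
      rw [this]; exact SetLike.mul_mem_graded hb' ha2
    · refine (congrArg₂ (fun s t => s + t) (h1 ⟨y.1, y.2.1⟩) (h2 ⟨y.1, y.2.2⟩)).trans ?_
      refine (Localization.add_mk _ _ _ _).trans ?_
      congr 1
      exact add_comm _ _
  neg_mem' := by
    intro f hf x
    obtain ⟨V, hV, ι, i, j, a, b, hb, ha, hb', hij, h1⟩ := hf x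
    exact ⟨V, hV, ι, i, j, -a, b, hb, neg_mem ha, hb', hij, fun y =>
      (congrArg Neg.neg (h1 y)).trans (Localization.neg_mk _ _)⟩

variable {𝒜}

theorem twistSections_ext {d : ℤ} {U : (Proj 𝒜).Opens} {s t : twistSections 𝒜 d U}
    (h : ∀ x, s.1 x = t.1 x) : s = t := Subtype.ext (funext h)

/-- Sections of the structure sheaf act by pointwise multiplication. -/
instance (d : ℤ) (U : (Proj 𝒜).Opens) : Module Γ(Proj 𝒜, U) (twistSections 𝒜 d U) where
  smul r s := ⟨fun x => (r.1 x).val * s.1 x,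
    isLocallyFraction_mul (zero_add d) (isLocallyFraction_val r) s.2⟩
  one_smul s := twistSections_ext fun x =>
    (congrArg (fun t => t * s.1 x) HomogeneousLocalization.val_one).trans (one_mul _)
  mul_smul _ _ s := twistSections_ext fun x =>
    (congrArg (fun t => t * s.1 x) (HomogeneousLocalization.val_mul _ _)).trans (mul_assoc _ _ _)
  smul_zero _ := twistSections_ext fun _ => mul_zero _
  smul_add _ _ _ := twistSections_ext fun _ => mul_add _ _ _
  add_smul _ _ s := twistSections_ext fun x =>
    (congrArg (fun t => t * s.1 x) (HomogeneousLocalization.val_add _ _)).trans (add_mul _ _ _)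
  zero_smul s := twistSections_ext fun x =>
    (congrArg (fun t => t * s.1 x) HomogeneousLocalization.val_zero).trans (zero_mul _)

/-- Restriction of sections of `𝒪(d)`. -/
def twistRes {d : ℤ} {U V : (Proj 𝒜).Opens} (h : V ≤ U) :
    twistSections 𝒜 d U →+ twistSections 𝒜 d V where
  toFun s := ⟨fun x => s.1 ⟨x.1, h x.2⟩, (isLocallyFraction 𝒜 d).res (homOfLE h) s.1 s.2⟩
  map_zero' := rfl
  map_add' _ _ := rfl

/-- The presheaf of abelian groups underlying `𝒪(d)`. -/
def twistPresheafAb (𝒜 : ℕ → σ) [GradedRing 𝒜] (d : ℤ) : TopCat.Presheaf Ab (Proj 𝒜) where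
  obj U := AddCommGrpCat.of (twistSections 𝒜 d U.unop)
  map i := AddCommGrpCat.ofHom (twistRes i.unop.le)

instance (d : ℤ) (U : (Proj 𝒜).Opensᵒᵖ) :
    Module ((Proj 𝒜).ringCatSheaf.obj.obj U) ((twistPresheafAb 𝒜 d).obj U) :=
  inferInstanceAs (Module Γ(Proj 𝒜, U.unop) (twistSections 𝒜 d U.unop))

theorem twistPresheafAb_isSheaf (𝒜 : ℕ → σ) [GradedRing 𝒜] (d : ℤ) :
    (twistPresheafAb 𝒜 d).IsSheaf := by
  rw [TopCat.Presheaf.isSheaf_iff_isSheaf_comp (forget Ab)]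
  exact TopCat.Presheaf.isSheaf_of_iso
    (NatIso.ofComponents (fun _ => Iso.refl _) (fun _ => rfl))
    (TopCat.subpresheafToTypes.isSheaf (isLocallyFraction 𝒜 d))

/-- Serre's twisting sheaf `𝒪(d)` on `Proj 𝒜`. -/
def twist (𝒜 : ℕ → σ) [GradedRing 𝒜] (d : ℤ) : (Proj 𝒜).Modules where
  val := PresheafOfModules.ofPresheaf (twistPresheafAb 𝒜 d) (fun _ _ _ _ _ => rfl)
  isSheaf := twistPresheafAb_isSheaf 𝒜 d

theorem val_fraction (y : ProjectiveSpectrum 𝒜) {i : ℕ} {a b : A} (ha : a ∈ 𝒜 i) (hb : b ∈ 𝒜 i)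
    (hy : b ∈ y.asHomogeneousIdeal.toIdeal.primeCompl) :
    (HomogeneousLocalization.mk ⟨i, ⟨a, ha⟩, ⟨b, hb⟩, hy⟩ : HLocAt 𝒜 y).val =
      Localization.mk a ⟨b, hy⟩ := HomogeneousLocalization.val_mk _

theorem exists_section {U : Opens (ProjectiveSpectrum.top 𝒜)} {f : (x : U) → LocAt 𝒜 x.1}
    (H : (isLocallyFraction 𝒜 0).pred f) :
    ∃ r : (ProjectiveSpectrum.Proj.structureSheaf 𝒜).1.obj (op U), ∀ x, (r.1 x).val = f x := by
  have hex : ∀ x : U, ∃ z : HLocAt 𝒜 x.1, z.val = f x := by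
    intro x
    obtain ⟨V, hV, ι, i, j, a, b, hb, ha, hb', hij, h1⟩ := H x
    obtain rfl : i = j := by omega
    refine ⟨HomogeneousLocalization.mk ⟨i, ⟨a, ha⟩, ⟨b, hb'⟩, hb ⟨x.1, hV⟩⟩, ?_⟩
    exact (HomogeneousLocalization.val_mk _).trans (h1 ⟨x.1, hV⟩).symm
  choose z hz using hex
  refine ⟨⟨z, fun x => ?_⟩, hz⟩
  obtain ⟨V, hV, ι, i, j, a, b, hb, ha, hb', hij, h1⟩ := H x
  obtain rfl : i = j := by omega
  refine ⟨V, hV, ι, i, ⟨a, ha⟩, ⟨b, hb'⟩, hb, fun y => HomogeneousLocalization.val_injective _ ?_⟩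
  exact (hz (ι y)).trans ((h1 y).trans
    (val_fraction (y.1 : ProjectiveSpectrum 𝒜) ha hb' (hb y)).symm)

theorem exists_twistMul {d e : ℤ} (h : d + e = 0) {U : (Proj 𝒜).Opens}
    (s : twistSections 𝒜 d U) (t : twistSections 𝒜 e U) :
    ∃ r : Γ(Proj 𝒜, U), ∀ x : (U : Opens (ProjectiveSpectrum 𝒜)),
      (r.1 x).val = s.1 x * t.1 x :=
  exists_section (isLocallyFraction_mul h s.2 t.2)

/-- The product of a section of `𝒪(d)` and a section of `𝒪(-d)`, a section of `𝒪`. -/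
def twistMul {d e : ℤ} (h : d + e = 0) {U : (Proj 𝒜).Opens}
    (s : twistSections 𝒜 d U) (t : twistSections 𝒜 e U) : Γ(Proj 𝒜, U) :=
  (exists_twistMul h s t).choose

theorem twistMul_val {d e : ℤ} (h : d + e = 0) {U : (Proj 𝒜).Opens}
    (s : twistSections 𝒜 d U) (t : twistSections 𝒜 e U)
    (x : (U : Opens (ProjectiveSpectrum 𝒜))) :
    ((twistMul h s t).1 x).val = s.1 x * t.1 x := (exists_twistMul h s t).choose_spec x

theorem section_ext {U : (Proj 𝒜).Opens} {r r' : Γ(Proj 𝒜, U)}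
    (h : ∀ x : (U : Opens (ProjectiveSpectrum 𝒜)), (r.1 x).val = (r'.1 x).val) : r = r' :=
  Subtype.ext (funext fun x => HomogeneousLocalization.val_injective _ (h x))

section
variable {d e : ℤ} (h : d + e = 0) {U V : (Proj 𝒜).Opens}

theorem twistMul_add_right (s : twistSections 𝒜 d U) (t t' : twistSections 𝒜 e U) :
    twistMul h s (t + t') = twistMul h s t + twistMul h s t' := section_ext fun x => by
  refine (twistMul_val h _ _ x).trans ((mul_add _ _ _).trans ?_)
  refine Eq.trans ?_ (HomogeneousLocalization.val_add _ _).symm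
  exact congrArg₂ (fun a b => a + b) (twistMul_val h s t x).symm (twistMul_val h s t' x).symm

theorem twistMul_add_left (s s' : twistSections 𝒜 d U) (t : twistSections 𝒜 e U) :
    twistMul h (s + s') t = twistMul h s t + twistMul h s' t := section_ext fun x => by
  refine (twistMul_val h _ _ x).trans ((add_mul _ _ _).trans ?_)
  refine Eq.trans ?_ (HomogeneousLocalization.val_add _ _).symm
  exact congrArg₂ (fun a b => a + b) (twistMul_val h s t x).symm (twistMul_val h s' t x).symm

theorem twistMul_zero_left (t : twistSections 𝒜 e U) :
    twistMul h (0 : twistSections 𝒜 d U) t = 0 := section_ext fun x => by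
  refine (twistMul_val h _ _ x).trans ((zero_mul _).trans ?_)
  exact HomogeneousLocalization.val_zero.symm

theorem twistMul_smul_right (r : Γ(Proj 𝒜, U)) (s : twistSections 𝒜 d U)
    (t : twistSections 𝒜 e U) :
    twistMul h s (r • t) = r * twistMul h s t := section_ext fun x => by
  refine (twistMul_val h _ _ x).trans ((mul_left_comm (s.1 x) (r.1 x).val (t.1 x)).trans ?_)
  refine Eq.trans ?_ (HomogeneousLocalization.val_mul _ _).symm
  exact congrArg (fun b => (r.1 x).val * b) (twistMul_val h s t x).symm

theorem twistMul_smul_left (r : Γ(Proj 𝒜, U)) (s : twistSections 𝒜 d U)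
    (t : twistSections 𝒜 e U) :
    twistMul h (r • s) t = r * twistMul h s t := section_ext fun x => by
  refine (twistMul_val h _ _ x).trans ((mul_assoc (r.1 x).val (s.1 x) (t.1 x)).trans ?_)
  refine Eq.trans ?_ (HomogeneousLocalization.val_mul _ _).symm
  exact congrArg (fun b => (r.1 x).val * b) (twistMul_val h s t x).symm

theorem twistMul_res (hV : V ≤ U) (s : twistSections 𝒜 d U) (t : twistSections 𝒜 e U) :
    (Proj 𝒜).presheaf.map (homOfLE hV).op (twistMul h s t) =
      twistMul h (twistRes hV s) (twistRes hV t) := section_ext fun x => by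
  exact (twistMul_val h s t ⟨x.1, hV x.2⟩).trans
    (twistMul_val h (twistRes hV s) (twistRes hV t) x).symm

end

/-- The canonical morphism `𝒪(d) ⟶ 𝒪(-d)^∨`, sending `s` to `t ↦ s * t`. -/
def twistToDual (𝒜 : ℕ → σ) [GradedRing 𝒜] {d e : ℤ} (h : d + e = 0) :
    twist 𝒜 d ⟶ dual (twist 𝒜 e) where
  val := PresheafOfModules.homMk
    { app U := AddCommGrpCat.ofHom
        { toFun := fun (s : twistSections 𝒜 d U.unop) =>
            (⟨fun V =>
                { toFun := fun (t : twistSections 𝒜 e V.1) =>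
                    twistMul h (twistRes V.2 s) t
                  map_add' := fun t t' => twistMul_add_right h _ t t'
                  map_smul' := fun r t => twistMul_smul_right h r _ t }, by
              intro V W hW (m : twistSections 𝒜 e V.1)
              exact twistMul_res h hW _ m⟩ : dualSections (twist 𝒜 e) U.unop)
          map_zero' := dualSections_ext fun V (t : twistSections 𝒜 e V.1) => twistMul_zero_left h t
          map_add' := fun s s' => dualSections_ext fun V (t : twistSections 𝒜 e V.1) =>
            twistMul_add_left h (twistRes V.2 s) (twistRes V.2 s') t }
      naturality := fun _ _ _ => rfl }
    (fun U (r : Γ(Proj 𝒜, U.unop)) (s : twistSections 𝒜 d U.unop) =>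
      dualSections_ext fun V (t : twistSections 𝒜 e V.1) =>
        twistMul_smul_left h ((Proj 𝒜).presheaf.map (homOfLE V.2).op r) (twistRes V.2 s) t)

end Twist

section Monad

attribute [local instance] Abelian.hasFiniteBiproducts MvPolynomial.gradedAlgebra

/-- The direct sum `M^{⊕ m}`. -/
abbrev power {X : Scheme.{u}} (M : X.Modules) (m : ℕ) : X.Modules := ⨁ fun _ : Fin m => M

/-- Given `φ : L ⟶ L'^∨`, the morphism `L^{⊕ m} ⟶ (L'^{⊕ m})^∨` acting by `φ` on each summand
(the pairing of `(s_i)` with `(t_i)` is `∑ φ(s_i)(t_i)`). -/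
def powerToDual {X : Scheme.{u}} {L L' : X.Modules} (φ : L ⟶ dual L') (m : ℕ) :
    power L m ⟶ dual (power L' m) :=
  biproduct.desc fun i => φ ≫ dualMap (biproduct.π (fun _ : Fin m => L') i)

/-- The dual of the complex `A ⟶ B ⟶ C`, namely `C^∨ ⟶ B^∨ ⟶ A^∨`. -/
def dualComplex {X : Scheme.{u}} (S : ShortComplex X.Modules) : ShortComplex X.Modules :=
  ShortComplex.mk (dualMap S.g) (dualMap S.f) (by rw [← dualMap_comp, S.zero, dualMap_zero])

/-- `E` is locally free (of finite rank): every point has an open neighbourhood `U` such that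
`E|_U` is isomorphic to `𝒪_U^{⊕ m}` for some `m`. -/
def IsLocallyFree {X : Scheme.{u}} (E : X.Modules) : Prop :=
  ∀ x : X, ∃ (U : X.Opens) (m : ℕ), x ∈ U ∧
    Nonempty (E.restrict U.ι ≅ power (structureModule U.toScheme) m)

/-- Projective space `ℙⁿ` over `K`, as `Proj K[x_0, …, x_n]`. -/
abbrev ProjSpace (n : ℕ) (K : Type u) [Field K] : Scheme.{u} :=
  Proj (MvPolynomial.homogeneousSubmodule (Fin (n + 1)) K)

/-- The sheaf `𝒪(d)` on `ℙⁿ`. -/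
abbrev twistingSheaf (n : ℕ) (K : Type u) [Field K] (d : ℤ) : (ProjSpace n K).Modules :=
  twist (MvPolynomial.homogeneousSubmodule (Fin (n + 1)) K) d

/-- The canonical morphism `𝒪(d) ⟶ 𝒪(e)^∨` on `ℙⁿ` for `d + e = 0`. -/
abbrev twistingSheafToDual (n : ℕ) (K : Type u) [Field K] {d e : ℤ} (h : d + e = 0) :
    twistingSheaf n K d ⟶ dual (twistingSheaf n K e) :=
  twistToDual (MvPolynomial.homogeneousSubmodule (Fin (n + 1)) K) h

variable {n : ℕ} {K : Type u} [Field K] {r c : ℕ}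

/-- A linear monad `𝒪(-1)^{⊕ c} ⟶ 𝒪^{⊕ r + 2c} ⟶ 𝒪(1)^{⊕ c}` on `ℙⁿ`. -/
structure LinearMonad (n : ℕ) (K : Type u) [Field K] (r c : ℕ) where
  α : power (twistingSheaf n K (-1)) c ⟶ power (structureModule (ProjSpace n K)) (r + 2 * c)
  β : power (structureModule (ProjSpace n K)) (r + 2 * c) ⟶ power (twistingSheaf n K 1) c
  zero : α ≫ β = 0
  mono_α : Mono α
  epi_β : Epi β

/-- A linear monad as a complex. -/
def LinearMonad.toComplex (M : LinearMonad n K r c) : ShortComplex (ProjSpace n K).Modules :=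
  ShortComplex.mk M.α M.β M.zero

/-- The cohomology sheaf `ker β / im α` of a linear monad. -/
def LinearMonad.cohomology (M : LinearMonad n K r c) : (ProjSpace n K).Modules :=
  M.toComplex.homology

/-- `M'` is the dual of the monad `M`: the canonical morphisms `𝒪(-1)^{⊕ c} ⟶ (𝒪(1)^{⊕ c})^∨`,
`𝒪^{⊕ r + 2c} ⟶ (𝒪^{⊕ r + 2c})^∨` and `𝒪(1)^{⊕ c} ⟶ (𝒪(-1)^{⊕ c})^∨` form an isomorphism from `M'`
to the complex with maps `β^∨` and `α^∨`. -/
def LinearMonad.IsDualOf (M' M : LinearMonad n K r c) : Prop :=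
  ∃ e : M'.toComplex ≅ dualComplex M.toComplex,
    e.hom.τ₁ = powerToDual (twistingSheafToDual n K (neg_add_cancel 1)) c ∧
    e.hom.τ₂ = powerToDual (unitToDual (ProjSpace n K)) (r + 2 * c) ∧
    e.hom.τ₃ = powerToDual (twistingSheafToDual n K (add_neg_cancel 1)) c

/-- `E` is (up to isomorphism) the cohomology of a linear monad with parameters `r` and `c`. -/
def IsInstantonSheaf (r c : ℕ) (E : (ProjSpace n K).Modules) : Prop :=
  ∃ M : LinearMonad n K r c, Nonempty (E ≅ M.cohomology)

/-- An instanton bundle of rank `r` and charge `c`: a locally free instanton sheaf. -/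
def IsInstantonBundle (r c : ℕ) (E : (ProjSpace n K).Modules) : Prop :=
  IsInstantonSheaf r c E ∧ IsLocallyFree E

end Monad

end
end Instanton

/-! Split the monad at `Z = ker β` into `0 → Z → 𝒪^{r+2c} → 𝒪(1)^c → 0` and `0 → 𝒪(-1)^c → Z → E →
0`. In both sequences the quotient is locally free, so locally they split and `ℋom(-, 𝒪)` keeps them
exact. Hence `β^∨` is a monomorphism with cokernel `Z^∨`. Moreover `α^∨` is the composite of the
epimorphisms `(𝒪^{r+2c})^∨ → Z^∨` and `Z^∨ → (𝒪(-1)^c)^∨`, and the kernel of the second is `E^∨`. So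
the dual complex has cohomology `E^∨`.

Left exactness of the dual is formal: morphisms `N ⟶ M^∨` and `M ⟶ N^∨` are the same pairings
(`transpose`), so the dual turns cokernels into kernels (`dualIsKernel`). Surjectivity is the only
place where local freeness enters the exactness argument (`epi_dualMap_of_shortExact`). It is used
in the form of local frames, which is equivalent to local freeness
(`isLocallyFree_iff_hasLocalFrames`) and passes to the dual by dual bases.

To obtain a linear monad from the dual complex, its terms are identified with `𝒪(-1)^c`, `𝒪^{r+2c}`
and `𝒪(1)^c`. The canonical maps `𝒪(d) ⟶ 𝒪(-d)^∨` for `d = ±1` are isomorphisms because a coordinate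
`x_i` and its inverse trivialize `𝒪(1)` and `𝒪(-1)` where `x_i ≠ 0`. -/

namespace Instanton
noncomputable section

/-! ### Sections of kernels, epimorphisms and isomorphisms of sheaves of modules. -/

section Sections

variable {X : Scheme.{u}} {M N : X.Modules}

theorem app_res (f : M ⟶ N) {U V : X.Opens} (h : V ≤ U) (m : Γ(M, U)) :
    f.app V (M.presheaf.map (homOfLE h).op m) = N.presheaf.map (homOfLE h).op (f.app U m) :=
  ConcreteCategory.congr_hom (f.mapPresheaf.naturality (homOfLE h).op) m

theorem eq_of_locally_eq {U : X.Opens} {s t : Γ(M, U)}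
    (h : ∀ x ∈ U, ∃ (V : X.Opens) (hV : V ≤ U), x ∈ V ∧
      M.presheaf.map (homOfLE hV).op s = M.presheaf.map (homOfLE hV).op t) : s = t := by
  choose V hV hx hst using h
  refine TopCat.Sheaf.eq_of_locally_eq' ⟨M.presheaf, M.isSheaf⟩ (fun x : U => V x.1 x.2) U
    (fun x => homOfLE (hV x.1 x.2)) (fun x hxU => ?_) s t (fun x => hst x.1 x.2)
  exact Opens.mem_iSup.mpr ⟨⟨x, hxU⟩, hx x hxU⟩

theorem hom_ext_apply {f g : M ⟶ N} (h : ∀ (U : X.Opens) (m : Γ(M, U)), f.app U m = g.app U m) :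
    f = g := by
  apply Scheme.Modules.hom_ext
  intro U
  ext m
  exact h U m

theorem isIso_of_bijective {f : M ⟶ N} (h : ∀ U, Function.Bijective (f.app U)) : IsIso f :=
  Scheme.Modules.Hom.isIso_iff_isIso_app.mpr fun U =>
    (ConcreteCategory.isIso_iff_bijective (f.app U)).mpr (h U)

theorem bijective_of_isIso (f : M ⟶ N) [IsIso f] (U : X.Opens) : Function.Bijective (f.app U) :=
  (ConcreteCategory.isIso_iff_bijective (f.app U)).mp inferInstance

theorem epi_of_locally_surjective (f : M ⟶ N)
    (h : ∀ (U : X.Opens) (n : Γ(N, U)), ∀ x ∈ U, ∃ (V : X.Opens) (hV : V ≤ U), x ∈ V ∧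
      ∃ m : Γ(M, V), f.app V m = N.presheaf.map (homOfLE hV).op n) : Epi f := by
  refine ⟨fun {P} g g' hg => hom_ext_apply fun U n => eq_of_locally_eq fun x hx => ?_⟩
  obtain ⟨V, hV, hxV, m, hm⟩ := h U n x hx
  refine ⟨V, hV, hxV, ?_⟩
  rw [← app_res, ← app_res, ← hm]
  exact congrArg (fun k : M ⟶ P => k.app V m) hg

/-- The functor of sections over `U`. -/
abbrev sectionsFunctor (X : Scheme.{u}) (U : X.Opens) : X.Modules ⥤ Ab.{u} :=
  Scheme.Modules.toPresheaf X ⋙ (evaluation _ _).obj (op U)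

instance (X : Scheme.{u}) (U : X.Opens) : PreservesFiniteLimits (sectionsFunctor X U) :=
  have : PreservesFiniteLimits (Scheme.Modules.toPresheaf X) :=
    PreservesLimits.preservesFiniteLimits _
  have : PreservesFiniteLimits ((evaluation X.Opensᵒᵖ Ab.{u}).obj (op U)) :=
    PreservesLimits.preservesFiniteLimits _
  comp_preservesFiniteLimits _ _

instance (X : Scheme.{u}) (U : X.Opens) : (sectionsFunctor X U).PreservesZeroMorphisms :=
  ⟨fun _ _ => rfl⟩

/-- Taking sections is left exact, so the preimage exists over all of `U`, without shrinking. -/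
theorem exact_sections {S : ShortComplex X.Modules} (hS : S.Exact) [Mono S.f] {U : X.Opens}
    {m : Γ(S.X₂, U)} (hm : S.g.app U m = 0) : ∃ k : Γ(S.X₁, U), S.f.app U k = m := by
  have h := hS.map_of_mono_of_preservesKernel (sectionsFunctor X U) inferInstance inferInstance
  exact (ShortComplex.ab_exact_iff _).mp h m hm

theorem injective_of_mono (f : M ⟶ N) [Mono f] (U : X.Opens) : Function.Injective (f.app U) :=
  (AddCommGrpCat.mono_iff_injective _).mp (inferInstanceAs (Mono ((sectionsFunctor X U).map f)))

/-- An epimorphism of `𝒪_X`-modules is locally surjective on sections: a section that vanishes in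
the sheafification of the presheaf cokernel vanishes locally in the presheaf cokernel. -/
theorem exists_local_lift (f : M ⟶ N) [Epi f] {U : X.Opens} (n : Γ(N, U)) {x : X} (hx : x ∈ U) :
    ∃ (V : X.Opens) (hV : V ≤ U), x ∈ V ∧
      ∃ m : Γ(M, V), f.app V m = N.presheaf.map (homOfLE hV).op n := by
  let J := Opens.grothendieckTopology X
  let P := cokernel f.val
  let q : N.val ⟶ P := cokernel.π f.val
  let P' : X.Modules := (PresheafOfModules.sheafification (𝟙 X.ringCatSheaf.obj)).obj P
  let η := (PresheafOfModules.sheafificationAdjunction (𝟙 X.ringCatSheaf.obj)).unit.app P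
  let g : N ⟶ P' := ⟨q ≫ η⟩
  have hg : f ≫ g = 0 := by
    apply SheafOfModules.hom_ext
    change f.val ≫ q ≫ η = 0
    rw [← Category.assoc, cokernel.condition, zero_comp]
  have hg0 : g = 0 := (cancel_epi f).mp (hg.trans comp_zero.symm)
  have hq : q ≫ η = 0 := congrArg SheafOfModules.Hom.val hg0
  -- The class of `n` in the presheaf cokernel dies in the sheafification, so it agrees with `0` on
  -- a covering sieve.
  have h1 : (toSheafify J P.presheaf).app (op U) (q.app (op U) n) =
      (toSheafify J P.presheaf).app (op U) 0 := by
    rw [map_zero]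
    exact congrArg (fun k : N.val ⟶ P'.val => k.app (op U) n) hq
  obtain ⟨V, i, hi, hxV⟩ :=
    Presheaf.equalizerSieve_mem J (toSheafify J P.presheaf) _ _ h1 x hx
  have h2 : q.app (op V) (N.val.map i.op n) = 0 :=
    (PresheafOfModules.naturality_apply q i.op n).trans (Eq.trans hi (map_zero _))
  -- Cokernels of presheaves are computed open by open, so vanishing over `V` yields an actual
  -- preimage over `V`.
  have hS := (ShortComplex.exact_cokernel f.val).map_of_epi_of_preservesCokernel
    (PresheafOfModules.evaluation _ (op V)) inferInstance inferInstance
  exact ⟨V, i.le, hxV, (ShortComplex.moduleCat_exact_iff _).mp hS _ h2⟩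

/-- A morphism of `𝒪_X`-modules is an isomorphism if it is bijective on all small enough open
subsets. -/
theorem isIso_of_locally_bijective (f : M ⟶ N)
    (h : ∀ x : X, ∃ V : X.Opens, x ∈ V ∧ ∀ W ≤ V, Function.Bijective (f.app W)) : IsIso f := by
  have hepi : Epi f := epi_of_locally_surjective f fun U n x hx => by
    obtain ⟨V, hxV, hV⟩ := h x
    obtain ⟨m, hm⟩ := (hV (U ⊓ V) inf_le_right).2 (N.presheaf.map (homOfLE inf_le_left).op n)
    exact ⟨U ⊓ V, inf_le_left, ⟨hx, hxV⟩, m, hm⟩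
  have hmono : Mono f := by
    refine ⟨fun {P} g g' hg => hom_ext_apply fun U n => eq_of_locally_eq fun x hx => ?_⟩
    obtain ⟨V, hxV, hV⟩ := h x
    refine ⟨U ⊓ V, inf_le_left, ⟨hx, hxV⟩, (hV _ inf_le_right).1 ?_⟩
    rw [app_res, app_res]
    exact congrArg (fun k : P ⟶ N => N.presheaf.map (homOfLE _).op (k.app U n)) hg
  exact isIso_of_mono_of_epi f

end Sections

/-! ### The self-adjunction of the dual and its left exactness. -/

section Transpose

variable {X : Scheme.{u}} {M N : X.Modules}

theorem dual_hom_ext {f g : N ⟶ dual M} (h : ∀ (U : X.Opens) (n : Γ(N, U)) (V) (m : Γ(M, V.1)),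
    (f.app U n : dualSections M U).1 V m = (g.app U n : dualSections M U).1 V m) : f = g :=
  hom_ext_apply fun U n => dualSections_ext (h U n)

/-- The adjoint `M ⟶ N^∨` of a morphism `N ⟶ M^∨`: both are the same bilinear pairing. -/
def transpose (f : N ⟶ dual M) : M ⟶ dual N where
  val := PresheafOfModules.homMk
    { app U := AddCommGrpCat.ofHom
        { toFun := fun (m : Γ(M, U.unop)) =>
            (⟨fun V =>
                { toFun := fun n => (f.app V.1 n : dualSections M V.1).1 ⟨V.1, le_rfl⟩
                    (M.presheaf.map (homOfLE V.2).op m)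
                  map_add' := fun n n' => by rw [map_add]; rfl
                  map_smul' := fun r n => by
                    rw [Scheme.Modules.Hom.app_smul]
                    refine (dualSections_smul_apply r _ _ _).trans ?_
                    refine congrArg (fun t : Γ(X, V.1) => t * _) ?_
                    exact ConcreteCategory.congr_hom (X.presheaf.map_id (op V.1)) r }, by
              intro V W h n
              refine ((f.app V.1 n : dualSections M V.1).2 ⟨V.1, le_rfl⟩ ⟨W.1, h⟩ h _).trans ?_
              rw [mres_res]
              exact congrArg (fun φ : dualSections M W.1 => φ.1 ⟨W.1, le_rfl⟩
                (M.presheaf.map (homOfLE W.2).op m)) (app_res f h n).symm⟩ : dualSections N U.unop)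
          map_zero' := dualSections_ext fun V n => by
            refine (congrArg ((f.app V.1 n : dualSections M V.1).1 ⟨V.1, le_rfl⟩)
              (map_zero _)).trans (map_zero _)
          map_add' := fun m m' => dualSections_ext fun V n => by
            refine (congrArg ((f.app V.1 n : dualSections M V.1).1 ⟨V.1, le_rfl⟩)
              (map_add _ m m')).trans (map_add _ _ _) }
      naturality := fun U U' i => by
        ext (m : Γ(M, U.unop))
        refine dualSections_ext fun V n => ?_
        exact congrArg ((f.app V.1 n : dualSections M V.1).1 ⟨V.1, le_rfl⟩)
          (mres_res M V.2 i.unop.le m) }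
    (fun U (r : Γ(X, U.unop)) (m : Γ(M, U.unop)) => dualSections_ext fun V n => by
      refine (congrArg ((f.app V.1 n : dualSections M V.1).1 ⟨V.1, le_rfl⟩)
        (Scheme.Modules.map_smul M (homOfLE V.2) r m)).trans (map_smul _ _ _))

theorem transpose_apply (f : N ⟶ dual M) {U : X.Opens} (m : Γ(M, U)) (V : {V : X.Opens // V ≤ U})
    (n : Γ(N, V.1)) : ((transpose f).app U m : dualSections N U).1 V n =
      (f.app V.1 n : dualSections M V.1).1 ⟨V.1, le_rfl⟩ (M.presheaf.map (homOfLE V.2).op m) := rfl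

theorem mres_self (M : X.Modules) {U : X.Opens} (h : U ≤ U) (m : Γ(M, U)) :
    M.presheaf.map (homOfLE h).op m = m :=
  ConcreteCategory.congr_hom (M.presheaf.map_id (op U)) m

theorem transpose_transpose (f : N ⟶ dual M) : transpose (transpose f) = f :=
  dual_hom_ext fun U n V m => by
    rw [transpose_apply, transpose_apply, mres_self, app_res]
    rfl

theorem transpose_comp_dualMap {M' : X.Modules} (f : N ⟶ dual M) (a : M' ⟶ M) :
    transpose (f ≫ dualMap a) = a ≫ transpose f :=
  dual_hom_ext fun U m V n => by
    rw [transpose_apply]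
    refine congrArg ((f.app V.1 n : dualSections M V.1).1 ⟨V.1, le_rfl⟩) ?_
    exact app_res a V.2 m

theorem comp_transpose {M' : X.Modules} (f : N ⟶ dual M) (a : M' ⟶ M) :
    transpose (a ≫ transpose f) = f ≫ dualMap a := by
  rw [← transpose_comp_dualMap, transpose_transpose]

theorem transpose_zero : transpose (0 : N ⟶ dual M) = 0 := rfl

/-- The dual of a cokernel is a kernel. -/
def dualIsKernel {A K E : X.Modules} {a : A ⟶ K} {p : K ⟶ E} (w : a ≫ p = 0)
    (hp : IsColimit (CokernelCofork.ofπ p w)) :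
    IsLimit (KernelFork.ofι (dualMap p) (f := dualMap a)
      (by rw [← dualMap_comp, w, dualMap_zero])) :=
  KernelFork.IsLimit.ofι _ _
    -- A morphism `g` killed by `a^∨` transposes to a morphism `K ⟶ N^∨` that kills `a`. It
    -- therefore descends to `E ⟶ N^∨`, whose transpose is the required lift.
    (fun {N} g hg => transpose (hp.desc (CokernelCofork.ofπ (transpose g)
      (by rw [← transpose_comp_dualMap, hg, transpose_zero]))))
    (fun {N} g hg => by
      rw [← comp_transpose, transpose_transpose]
      exact (congrArg transpose (hp.fac _ WalkingParallelPair.one)).trans (transpose_transpose g))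
    (fun {N} g hg m hm => by
      rw [← transpose_transpose m]
      congr 1
      refine Cofork.IsColimit.hom_ext hp ?_
      have w' : a ≫ transpose g = 0 := by rw [← transpose_comp_dualMap, hg, transpose_zero]
      exact ((transpose_comp_dualMap m p).symm.trans (congrArg transpose hm)).trans
        (hp.fac (CokernelCofork.ofπ (transpose g) w') WalkingParallelPair.one).symm)

theorem dualMap_add (f g : M ⟶ N) : dualMap (f + g) = dualMap f + dualMap g :=
  dual_hom_ext fun U φ V m => map_add ((φ : dualSections N U).1 V) (f.app V.1 m) (g.app V.1 m)

theorem dualMap_id (M : X.Modules) : dualMap (𝟙 M) = 𝟙 (dual M) := rfl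

theorem dualMap_sum {ι : Type*} (s : Finset ι) (f : ι → (M ⟶ N)) :
    dualMap (∑ i ∈ s, f i) = ∑ i ∈ s, dualMap (f i) :=
  map_sum (AddMonoidHom.mk' (fun f : M ⟶ N => dualMap f) dualMap_add) f s

/-- An isomorphism `M ≅ N` induces an isomorphism `N^∨ ≅ M^∨`. -/
def dualIso (e : M ≅ N) : dual N ≅ dual M where
  hom := dualMap e.hom
  inv := dualMap e.inv
  hom_inv_id := by rw [← dualMap_comp, e.inv_hom_id, dualMap_id]
  inv_hom_id := by rw [← dualMap_comp, e.hom_inv_id, dualMap_id]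

end Transpose

/-! ### Local frames, surjectivity of the dual map, and dual frames. -/

section Frames

variable {X : Scheme.{u}} {M N : X.Modules}

/-- The linear combinations of the sections `e i` over an open subset `W ≤ V`. -/
def combination {V : X.Opens} {ι : Type} [Fintype ι] (e : ι → Γ(M, V)) {W : X.Opens} (h : W ≤ V) :
    (ι → Γ(X, W)) →ₗ[Γ(X, W)] Γ(M, W) :=
  Fintype.linearCombination Γ(X, W) fun i => M.presheaf.map (homOfLE h).op (e i)

theorem combination_apply {V : X.Opens} {ι : Type} [Fintype ι] (e : ι → Γ(M, V)) {W : X.Opens}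
    (h : W ≤ V) (c : ι → Γ(X, W)) :
    combination e h c = ∑ i, c i • M.presheaf.map (homOfLE h).op (e i) := rfl

/-- The sections `e i` form a basis of `M` over every open subset of `V`. -/
def IsFrame {V : X.Opens} {ι : Type} [Fintype ι] (e : ι → Γ(M, V)) : Prop :=
  ∀ (W : X.Opens) (h : W ≤ V), Function.Bijective (combination e h)

/-- Every point has a neighbourhood over which `M` has a finite frame. -/
def HasLocalFrames (M : X.Modules) : Prop :=
  ∀ x : X, ∃ (V : X.Opens) (m : ℕ) (e : Fin m → Γ(M, V)), x ∈ V ∧ IsFrame e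

theorem combination_res {V : X.Opens} {ι : Type} [Fintype ι] (e : ι → Γ(M, V)) {W W' : X.Opens}
    (h : W ≤ V) (h' : W' ≤ W) (c : ι → Γ(X, W)) :
    M.presheaf.map (homOfLE h').op (combination e h c) =
      combination e (h'.trans h) fun i => X.presheaf.map (homOfLE h').op (c i) := by
  simp only [combination_apply, map_sum, Scheme.Modules.map_smul, mres_res]

theorem combination_of_res {V V' : X.Opens} {ι : Type} [Fintype ι] (e : ι → Γ(M, V)) {W : X.Opens}
    (h : V' ≤ V) (h' : W ≤ V') (c : ι → Γ(X, W)) :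
    combination (fun i => M.presheaf.map (homOfLE h).op (e i)) h' c =
      combination e (h'.trans h) c := by
  simp only [combination_apply, mres_res]

theorem app_combination (f : M ⟶ N) {V : X.Opens} {ι : Type} [Fintype ι] (e : ι → Γ(M, V))
    {W : X.Opens} (h : W ≤ V) (c : ι → Γ(X, W)) :
    f.app W (combination e h c) = combination (fun i => f.app V (e i)) h c := by
  simp only [combination_apply, map_sum, Scheme.Modules.Hom.app_smul, app_res]

theorem IsFrame.map_isIso (f : M ⟶ N) [IsIso f] {V : X.Opens} {ι : Type} [Fintype ι]
    {e : ι → Γ(M, V)} (he : IsFrame e) : IsFrame fun i => f.app V (e i) := fun W h => by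
  have := (bijective_of_isIso f W).comp (he W h)
  convert this using 1
  ext c
  exact (app_combination f e h c).symm

theorem isIso_of_isFrame (f : M ⟶ N) {ι : Type} [Fintype ι]
    {e : ι → Γ(M, ⊤)} (he : IsFrame e) (he' : IsFrame fun i => f.app ⊤ (e i)) : IsIso f := by
  refine isIso_of_bijective fun W => ?_
  refine (Function.Bijective.of_comp_iff _ (he W le_top)).mp ?_
  convert he' W le_top using 1
  ext c
  exact app_combination f e le_top c

/-- If `M₃` has local frames and `0 ⟶ M₁ ⟶ M₂ ⟶ M₃ ⟶ 0` is exact, then `M₂^∨ ⟶ M₁^∨` is an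
epimorphism. -/
theorem epi_dualMap_of_shortExact {S : ShortComplex X.Modules} (hS : S.ShortExact)
    (h₃ : HasLocalFrames S.X₃) : Epi (dualMap S.f) := by
  have := hS.mono_f
  have := hS.epi_g
  refine epi_of_locally_surjective _ fun U (φ : dualSections S.X₁ U) x hx => ?_
  obtain ⟨V, m, e, hxV, he⟩ := h₃ x
  -- Lifting the finitely many frame sections of `X₃` near `x` gives, over the intersection `V₀`, a
  -- splitting of the sequence.
  choose V' hV' hxV' l hl using fun i => exists_local_lift S.g (e i) hxV
  let V₀ : X.Opens := (U ⊓ V) ⊓ Finset.univ.inf V'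
  have hV₀U : V₀ ≤ U := inf_le_left.trans inf_le_left
  have hV₀V : V₀ ≤ V := inf_le_left.trans inf_le_right
  have hV₀V' : ∀ i, V₀ ≤ V' i := fun i => inf_le_right.trans (Finset.inf_le (Finset.mem_univ i))
  have hxV₀ : x ∈ V₀ := by
    refine ⟨⟨hx, hxV⟩, ?_⟩
    rw [Opens.coe_finset_inf]
    simpa using hxV'
  let l' : Fin m → Γ(S.X₂, V₀) := fun i => S.X₂.presheaf.map (homOfLE (hV₀V' i)).op (l i)
  have hl' : ∀ {W : X.Opens} (h : W ≤ V₀) (c : Fin m → Γ(X, W)),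
      S.g.app W (combination l' h c) = combination e (h.trans hV₀V) c := fun h c => by
    rw [app_combination, ← combination_of_res e hV₀V h]
    congr 2
    ext i
    simp only [l', app_res, hl, mres_res]
  have hgf : ∀ {W : X.Opens} (k : Γ(S.X₁, W)), S.g.app W (S.f.app W k) = 0 := fun {W} k =>
    congrArg (fun t : S.X₁ ⟶ S.X₃ => t.app W k) S.zero
  -- With `huniq` below: over each `W ≤ V₀`, `X₂` is the direct sum of `X₁` and the span of the
  -- lifts. The component `k` in `X₁` is the projection, and `φ ∘ k` extends `φ`.
  have hex : ∀ {W : X.Opens} (h : W ≤ V₀) (t : Γ(S.X₂, W)), ∃ (k : Γ(S.X₁, W))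
      (c : Fin m → Γ(X, W)), S.f.app W k + combination l' h c = t := fun {W} h t => by
    obtain ⟨c, hc⟩ := (he W (h.trans hV₀V)).2 (S.g.app W t)
    obtain ⟨k, hk⟩ := exact_sections hS.exact (m := t - combination l' h c)
      (by rw [map_sub, hl', hc, sub_self])
    exact ⟨k, c, by rw [hk, sub_add_cancel]⟩
  have huniq : ∀ {W : X.Opens} (h : W ≤ V₀) (k k' : Γ(S.X₁, W)) (c c' : Fin m → Γ(X, W)),
      S.f.app W k + combination l' h c = S.f.app W k' + combination l' h c' → k = k' :=
    fun {W} h k k' c c' hkc => by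
    have h1 := congrArg (S.g.app W) hkc
    rw [map_add, map_add, hgf, hgf, zero_add, zero_add, hl', hl'] at h1
    obtain rfl := (he W (h.trans hV₀V)).1 h1
    exact injective_of_mono S.f W (add_right_cancel hkc)
  choose k c hkc using @hex
  refine ⟨V₀, hV₀U, hxV₀, (⟨fun W =>
    { toFun := fun t => φ.1 ⟨W.1, W.2.trans hV₀U⟩ (k W.2 t)
      map_add' := fun t t' => ?_
      map_smul' := fun r t => ?_ }, ?_⟩ : dualSections S.X₂ V₀), ?_⟩
  -- The function `k` is only chosen pointwise. Its additivity, linearity, compatibility with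
  -- restriction and the identity `k ∘ f = id` all come from uniqueness of the decomposition.
  · rw [← map_add]
    congr 1
    refine huniq W.2 _ _ (c W.2 (t + t')) (c W.2 t + c W.2 t') ?_
    rw [hkc, map_add, map_add, add_add_add_comm, hkc, hkc]
  · rw [RingHom.id_apply, ← map_smul]
    congr 1
    refine huniq W.2 _ _ (c W.2 (r • t)) (r • c W.2 t) ?_
    rw [hkc, Scheme.Modules.Hom.app_smul, (combination l' W.2).map_smul, ← smul_add, hkc]
  · intro W W' h t
    refine (φ.2 ⟨W.1, W.2.trans hV₀U⟩ ⟨W'.1, W'.2.trans hV₀U⟩ h _).trans ?_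
    refine congrArg (φ.1 ⟨W'.1, W'.2.trans hV₀U⟩) ?_
    refine huniq W'.2 _ _ (fun i => X.presheaf.map (homOfLE h).op (c W.2 t i))
      (c W'.2 (S.X₂.presheaf.map (homOfLE h).op t)) ?_
    rw [hkc, app_res, ← combination_res l' W.2 h, ← map_add, hkc]
  · refine dualSections_ext fun W t => ?_
    refine congrArg (φ.1 ⟨W.1, W.2.trans hV₀U⟩) ?_
    refine huniq W.2 _ _ (c W.2 (S.f.app W.1 t)) 0 ?_
    exact (hkc W.2 (S.f.app W.1 t)).trans (by rw [map_zero, add_zero])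

/-- The coordinates with respect to a frame. -/
def IsFrame.coord {V : X.Opens} {ι : Type} [Fintype ι] {e : ι → Γ(M, V)} (he : IsFrame e)
    {W : X.Opens} (h : W ≤ V) : Γ(M, W) ≃ₗ[Γ(X, W)] (ι → Γ(X, W)) :=
  (LinearEquiv.ofBijective _ (he W h)).symm

theorem IsFrame.combination_coord {V : X.Opens} {ι : Type} [Fintype ι] {e : ι → Γ(M, V)}
    (he : IsFrame e) {W : X.Opens} (h : W ≤ V) (s : Γ(M, W)) :
    combination e h (he.coord h s) = s :=
  (LinearEquiv.ofBijective _ (he W h)).apply_symm_apply s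

theorem IsFrame.coord_combination {V : X.Opens} {ι : Type} [Fintype ι] {e : ι → Γ(M, V)}
    (he : IsFrame e) {W : X.Opens} (h : W ≤ V) (c : ι → Γ(X, W)) :
    he.coord h (combination e h c) = c :=
  (LinearEquiv.ofBijective _ (he W h)).symm_apply_apply c

/-- The dual frame. -/
def IsFrame.dualFrame {V : X.Opens} {ι : Type} [Fintype ι] {e : ι → Γ(M, V)}
    (he : IsFrame e) (i : ι) : dualSections M V :=
  ⟨fun W => LinearMap.proj i ∘ₗ (he.coord W.2).toLinearMap, fun W W' h s => by
    change X.presheaf.map (homOfLE h).op (he.coord W.2 s i) = he.coord W'.2 _ i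
    -- Coordinates commute with restriction because linear combinations do.
    conv_rhs => rw [← he.combination_coord W.2 s, combination_res, he.coord_combination]⟩

theorem dualSections_sum_apply {U : X.Opens} {ι : Type} [Fintype ι] (φ : ι → dualSections M U)
    (V : {V : X.Opens // V ≤ U}) (m : Γ(M, V.1)) :
    (∑ i, φ i).1 V m = ∑ i, (φ i).1 V m :=
  map_sum (AddMonoidHom.mk' (fun φ : dualSections M U => φ.1 V m) fun _ _ => rfl) φ _

theorem combination_dual_apply {V : X.Opens} {ι : Type} [Fintype ι] (φ : ι → dualSections M V)
    {W : X.Opens} (h : W ≤ V) (c : ι → Γ(X, W)) (W' : {W' : X.Opens // W' ≤ W}) (m : Γ(M, W'.1)) :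
    (combination (M := dual M) φ h c : dualSections M W).1 W' m =
      ∑ i, X.presheaf.map (homOfLE W'.2).op (c i) * (φ i).1 ⟨W'.1, W'.2.trans h⟩ m :=
  dualSections_sum_apply _ W' m

theorem IsFrame.coord_res_self {V : X.Opens} {ι : Type} [Fintype ι] [DecidableEq ι]
    {e : ι → Γ(M, V)} (he : IsFrame e) {W : X.Opens} (h : W ≤ V) (i : ι) :
    he.coord h (M.presheaf.map (homOfLE h).op (e i)) = Pi.single i 1 := by
  have : combination e h (Pi.single i 1) = M.presheaf.map (homOfLE h).op (e i) :=
    (Fintype.linearCombination_apply_single _ _ _ _).trans (one_smul _ _)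
  rw [← this, he.coord_combination]

/-- Evaluating a combination of the dual frame at `e j` returns its `j`-th coefficient. Conversely a
functional is determined by its values on the `e i`, which serve as its coefficients. -/
theorem IsFrame.isFrame_dualFrame {V : X.Opens} {ι : Type} [Fintype ι] {e : ι → Γ(M, V)}
    (he : IsFrame e) : IsFrame (M := dual M) he.dualFrame := fun W h => by
  classical
  constructor
  · intro c c' hc
    have key : ∀ (c : ι → Γ(X, W)) (j : ι),
        (combination (M := dual M) he.dualFrame h c : dualSections M W).1 ⟨W, le_rfl⟩
          (M.presheaf.map (homOfLE h).op (e j)) = c j := fun c j => by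
      refine (combination_dual_apply _ h c _ _).trans ?_
      have h2 : ∀ r : Γ(X, W), X.presheaf.map (homOfLE (le_refl W)).op r = r :=
        ConcreteCategory.congr_hom (X.presheaf.map_id (op W))
      refine (Finset.sum_congr rfl fun i _ => congrArg₂ (fun a b : Γ(X, W) => a * b) (h2 (c i))
        (congrFun (he.coord_res_self h j) i)).trans ?_
      simp [Pi.single_apply]
    ext j
    rw [← key c j, ← key c' j, hc]
  · intro (φ : dualSections M W)
    refine ⟨fun i => φ.1 ⟨W, le_rfl⟩ (M.presheaf.map (homOfLE h).op (e i)), ?_⟩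
    refine dualSections_ext fun W' m => ?_
    rw [combination_dual_apply]
    conv_rhs => rw [← he.combination_coord (W'.2.trans h) m, combination_apply, map_sum]
    refine Finset.sum_congr rfl fun i _ => ?_
    rw [map_smul, smul_eq_mul, mul_comm, φ.2 ⟨W, le_rfl⟩ W' W'.2, mres_res]
    rfl

theorem HasLocalFrames.dual (hM : HasLocalFrames M) : HasLocalFrames (dual M) := fun x => by
  obtain ⟨V, m, e, hx, he⟩ := hM x
  exact ⟨V, m, he.dualFrame, hx, he.isFrame_dualFrame⟩

theorem HasLocalFrames.of_iso (hM : HasLocalFrames M) (i : M ≅ N) : HasLocalFrames N := fun x => by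
  obtain ⟨V, m, e, hx, he⟩ := hM x
  exact ⟨V, m, _, hx, he.map_isIso i.hom⟩

end Frames

/-! ### Finite direct sums, free modules, and local freeness in terms of frames. -/

section Power

attribute [local instance] Abelian.hasFiniteBiproducts

variable {X : Scheme.{u}} {M N : X.Modules}

theorem sum_app {ι : Type*} (s : Finset ι) (f : ι → (M ⟶ N)) {U : X.Opens} (m : Γ(M, U)) :
    (∑ i ∈ s, f i).app U m = ∑ i ∈ s, (f i).app U m :=
  map_sum (AddMonoidHom.mk' (fun f : M ⟶ N => f.app U m) fun _ _ => rfl) f s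

/-- The sections of a direct sum are the tuples of sections. -/
theorem power_total {m : ℕ} {U : X.Opens} (s : Γ(power M m, U)) :
    ∑ i, (biproduct.ι (fun _ : Fin m => M) i).app U ((biproduct.π (fun _ : Fin m => M) i).app U s)
      = s := by
  have h := congrArg (fun f : power M m ⟶ power M m => f.app U s)
    (biproduct.total (f := fun _ : Fin m => M))
  exact (sum_app _ _ s).symm.trans h

theorem power_π_ι {m : ℕ} {U : X.Opens} (i j : Fin m) (s : Γ(M, U)) :
    (biproduct.π (fun _ : Fin m => M) j).app U ((biproduct.ι (fun _ : Fin m => M) i).app U s) =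
      if i = j then s else 0 := by
  refine (congrArg (fun f : M ⟶ M => f.app U s) (biproduct.ι_π (fun _ : Fin m => M) i j)).trans ?_
  split_ifs with h
  · subst h; rfl
  · rfl

/-- If `u` generates `M` freely over `V`, its images under the inclusions form a frame of the
direct sum. -/
theorem isFrame_power (m : ℕ) {V : X.Opens} {u : Γ(M, V)}
    (hu : ∀ (W : X.Opens) (h : W ≤ V),
      Function.Bijective fun c : Γ(X, W) => c • M.presheaf.map (homOfLE h).op u) :
    IsFrame fun i => (biproduct.ι (fun _ : Fin m => M) i).app V u := fun W h => by
  have key : ∀ c : Fin m → Γ(X, W),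
      combination (fun i => (biproduct.ι (fun _ : Fin m => M) i).app V u) h c =
        ∑ i, (biproduct.ι (fun _ : Fin m => M) i).app W (c i • M.presheaf.map (homOfLE h).op u) :=
    fun c => by
      rw [combination_apply]
      refine Finset.sum_congr rfl fun i _ => ?_
      rw [Scheme.Modules.Hom.app_smul, app_res]
  constructor
  · intro c c' hc
    ext j
    rw [key, key] at hc
    refine (hu W h).1 ?_
    have h1 := congrArg ((biproduct.π (fun _ : Fin m => M) j).app W) hc
    simpa only [map_sum, power_π_ι, Finset.sum_ite_eq', Finset.mem_univ, if_true] using h1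
  · intro s
    choose c hc using fun i => (hu W h).2 ((biproduct.π (fun _ : Fin m => M) i).app W s)
    refine ⟨c, (key c).trans (Eq.trans ?_ (power_total s))⟩
    exact Finset.sum_congr rfl fun i _ => congrArg _ (hc i)

theorem unit_smul_res_one {V W : X.Opens} (h : W ≤ V) (c : Γ(X, W)) :
    c • (structureModule X).presheaf.map (homOfLE h).op (1 : Γ(X, V)) = c := by
  refine Eq.trans ?_ (mul_one c)
  exact congrArg (fun r : Γ(X, W) => c * r) (map_one (X.presheaf.map (homOfLE h).op).hom)

theorem isFrame_power_structureModule (m : ℕ) :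
    IsFrame fun i => (biproduct.ι (fun _ : Fin m => structureModule X) i).app ⊤ (1 : Γ(X, ⊤)) := by
  refine isFrame_power m fun W h => ?_
  have : (fun c : Γ(X, W) => c • (structureModule X).presheaf.map (homOfLE h).op (1 : Γ(X, ⊤))) =
      id := funext fun c => unit_smul_res_one h c
  exact this ▸ Function.bijective_id

/-- The morphism `𝒪_X ⟶ M` given by a global section. -/
def homOfSection (s : Γ(M, ⊤)) : structureModule X ⟶ M where
  val := PresheafOfModules.homMk
    { app U := AddCommGrpCat.ofHom
        { toFun := fun (r : Γ(X, U.unop)) =>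
            (r • M.presheaf.map (homOfLE (le_top : U.unop ≤ ⊤)).op s : Γ(M, U.unop))
          map_zero' := zero_smul Γ(X, U.unop) (_ : Γ(M, U.unop))
          map_add' := fun r r' => add_smul (R := Γ(X, U.unop)) (M := Γ(M, U.unop)) r r' _ }
      naturality := fun U U' i => by
        ext (r : Γ(X, U.unop))
        refine Eq.trans ?_ (Scheme.Modules.map_smul M i.unop r _).symm
        exact congrArg (fun t : Γ(M, U'.unop) =>
          HSMul.hSMul (α := Γ(X, U'.unop)) (X.presheaf.map i r) t)
            (mres_res M i.unop.le le_top s).symm }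
    (fun U (r : Γ(X, U.unop)) (r' : Γ(X, U.unop)) =>
      mul_smul (α := Γ(X, U.unop)) (β := Γ(M, U.unop)) r r' _)

theorem homOfSection_one (s : Γ(M, ⊤)) : (homOfSection s).app ⊤ (1 : Γ(X, ⊤)) = s :=
  (one_smul Γ(X, ⊤) _).trans (mres_self M le_top s)

/-- A module with a global frame is free. -/
def isoOfIsFrame {m : ℕ} {e : Fin m → Γ(M, ⊤)} (he : IsFrame e) :
    power (structureModule X) m ≅ M :=
  have : IsIso (biproduct.desc fun i => homOfSection (e i)) := by
    -- The morphism carries the standard frame to `e`, and a morphism that carries a global frame to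
    -- a frame is bijective on sections.
    refine isIso_of_isFrame _ (isFrame_power_structureModule m) ?_
    convert he using 1
    ext i
    refine Eq.trans ?_ (homOfSection_one (e i))
    exact congrArg (fun f : structureModule X ⟶ M => f.app ⊤ (1 : Γ(X, ⊤)))
      (biproduct.ι_desc (fun i => homOfSection (e i)) i)
  asIso (biproduct.desc fun i => homOfSection (e i))

/-- The sections of `M|_V` over `W`, as sections of `M`. -/
def unrestrict {V : X.Opens} {W : V.toScheme.Opens} (s : Γ(M.restrict V.ι, W)) :
    Γ(M, V.ι ''ᵁ W) := s

/-- Scalars act on the restricted module through `V.ι.appIso W`, which is the identity. -/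
theorem unrestrict_smul {V : X.Opens} {W : V.toScheme.Opens} (r : Γ(X, V.ι ''ᵁ W))
    (s : Γ(M.restrict V.ι, W)) :
    unrestrict (HSMul.hSMul (α := Γ(V.toScheme, W)) r s) = r • unrestrict s := by
  change (V.ι.appIso W).inv r • unrestrict s = _
  rw [Scheme.Opens.ι_appIso]
  rfl

theorem unrestrict_sum {V : X.Opens} {W : V.toScheme.Opens} {ι : Type} [Fintype ι]
    (s : ι → Γ(M.restrict V.ι, W)) : unrestrict (∑ i, s i) = ∑ i, unrestrict (s i) := rfl

theorem unrestrict_combination {V : X.Opens} {ι : Type} [Fintype ι]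
    (e : ι → Γ(M.restrict V.ι, ⊤)) {W : V.toScheme.Opens} (h : V.ι ''ᵁ W ≤ V.ι ''ᵁ ⊤)
    (c : ι → Γ(X, V.ι ''ᵁ W)) :
    unrestrict (combination (X := V.toScheme) e (le_top : W ≤ ⊤) c) =
      combination (fun i => unrestrict (e i)) h c :=
  (unrestrict_sum _).trans (Finset.sum_congr rfl fun i _ => unrestrict_smul (c i) _)

theorem isFrame_restrict_iff {V : X.Opens} {ι : Type} [Fintype ι] (e : ι → Γ(M.restrict V.ι, ⊤)) :
    IsFrame e ↔ IsFrame fun i => unrestrict (e i) := by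
  constructor
  · intro he W h
    -- Every open subset of `V` is the image of its preimage, so both frame conditions range over
    -- the same opens.
    obtain ⟨W, rfl⟩ : ∃ W', W = V.ι ''ᵁ W' := ⟨V.ι ⁻¹ᵁ W, by
      rw [Scheme.Hom.image_preimage_eq_opensRange_inf, Scheme.Opens.opensRange_ι]
      refine (inf_eq_right.mpr (h.trans ?_)).symm
      simp⟩
    have h1 := he W le_top
    have h2 : ⇑(combination (fun i => unrestrict (e i)) h) = fun c =>
      unrestrict (combination (X := V.toScheme) e (le_top : W ≤ ⊤) c) :=
        funext fun c => (unrestrict_combination e h c).symm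
    rw [h2]
    exact h1
  · intro he W h
    have hW : V.ι ''ᵁ W ≤ V.ι ''ᵁ ⊤ := Scheme.Hom.image_mono _ h
    have h1 := he _ hW
    have h2 : ⇑(combination (fun i => unrestrict (e i)) hW) = fun c =>
      unrestrict (combination (X := V.toScheme) e h c) :=
        funext fun c => (unrestrict_combination e hW c).symm
    rw [h2] at h1
    exact h1

theorem IsFrame.res {V V' : X.Opens} {ι : Type} [Fintype ι] {e : ι → Γ(M, V)} (he : IsFrame e)
    (h : V' ≤ V) : IsFrame fun i => M.presheaf.map (homOfLE h).op (e i) := fun W h' => by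
  rw [show ⇑(combination (fun i => M.presheaf.map (homOfLE h).op (e i)) h') =
    combination e (h'.trans h) from funext (combination_of_res e h h')]
  exact he W _

/-- A trivialization carries the standard basis to a frame, and a frame defines a trivialization. -/
theorem isLocallyFree_iff_hasLocalFrames : IsLocallyFree M ↔ HasLocalFrames M := by
  constructor
  · intro h x
    obtain ⟨U, m, hx, ⟨i⟩⟩ := h x
    have he := (isFrame_power_structureModule (X := U.toScheme) m).map_isIso i.inv
    exact ⟨U.ι ''ᵁ ⊤, m, _, by simpa using hx, (isFrame_restrict_iff _).mp he⟩
  · intro h x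
    obtain ⟨V, m, e, hx, he⟩ := h x
    -- The two opens coincide; restricting along this inclusion turns `e` into sections over `V.ι
    -- ''ᵁ ⊤`, as needed for global sections of `M|_V`.
    have hV : V.ι ''ᵁ ⊤ ≤ V := by simp
    exact ⟨V, m, hx, ⟨(isoOfIsFrame ((isFrame_restrict_iff (M := M) _).mpr (he.res hV))).symm⟩⟩

end Power

/-! ### The structure sheaf is its own dual. -/

section Unit

variable {X : Scheme.{u}}

theorem unitToDual_apply {U : X.Opens} (s : Γ(X, U)) (V : {V : X.Opens // V ≤ U}) (t : Γ(X, V.1)) :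
    ((unitToDual X).app U s : dualSections (structureModule X) U).1 V t =
      X.presheaf.map (homOfLE V.2).op s * t := rfl

/-- The inverse is evaluation at `1`: linearity gives `φ(t) = t φ(1)`. -/
instance isIso_unitToDual (X : Scheme.{u}) : IsIso (unitToDual X) := by
  refine isIso_of_bijective fun U => ⟨fun (s s' : Γ(X, U)) h => ?_,
    fun (φ : dualSections (structureModule X) U) => ⟨φ.1 ⟨U, le_rfl⟩ (1 : Γ(X, U)), ?_⟩⟩
  · have h1 := congrArg (fun φ : dualSections (structureModule X) U =>
      φ.1 ⟨U, le_rfl⟩ (1 : Γ(X, U))) h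
    have h2 : ∀ r : Γ(X, U), X.presheaf.map (homOfLE (le_refl U)).op r * 1 = r := fun r =>
      (mul_one _).trans (ConcreteCategory.congr_hom (X.presheaf.map_id (op U)) r)
    exact (h2 s).symm.trans (h1.trans (h2 s'))
  · refine dualSections_ext fun V (t : Γ(X, V.1)) => ?_
    refine (unitToDual_apply _ V t).trans ?_
    have h1 := φ.2 ⟨U, le_rfl⟩ V V.2 (1 : Γ(X, U))
    refine (congrArg (fun r : Γ(X, V.1) => r * t) h1).trans ?_
    refine (mul_comm _ _).trans ?_
    refine (map_smul (φ.1 V) t _).symm.trans (congrArg (φ.1 V) ?_)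
    exact unit_smul_res_one V.2 t

end Unit

/-! ### Local trivializations of the twisting sheaves and their duality. -/

section Twist

variable {A : Type u} {σ : Type*} [CommRing A] [SetLike σ A] [AddSubgroupClass σ A]
variable {𝒜 : ℕ → σ} [GradedRing 𝒜]

/-- `u` and `v` are mutually inverse sections of `𝒪(d)` and `𝒪(-d)` over `V`. -/
def IsInversePair {d e : ℤ} {V : (Proj 𝒜).Opens} (u : twistSections 𝒜 d V)
    (v : twistSections 𝒜 e V) : Prop :=
  ∀ x : (V : Opens (ProjectiveSpectrum 𝒜)), u.1 x * v.1 x = 1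

theorem IsInversePair.symm {d e : ℤ} {V : (Proj 𝒜).Opens} {u : twistSections 𝒜 d V}
    {v : twistSections 𝒜 e V} (h : IsInversePair u v) : IsInversePair v u :=
  fun x => (mul_comm _ _).trans (h x)

theorem IsInversePair.res {d e : ℤ} {V W : (Proj 𝒜).Opens} {u : twistSections 𝒜 d V}
    {v : twistSections 𝒜 e V} (h : IsInversePair u v) (hW : W ≤ V) :
    IsInversePair (twistRes hW u) (twistRes hW v) := fun x => h ⟨x.1, hW x.2⟩

theorem twist_smul_apply {d : ℤ} {U : (Proj 𝒜).Opens} (r : Γ(Proj 𝒜, U))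
    (s : twistSections 𝒜 d U) (x : (U : Opens (ProjectiveSpectrum 𝒜))) :
    (r • s).1 x = (r.1 x).val * s.1 x := rfl

theorem IsInversePair.twistMul_smul {d e : ℤ} (hde : d + e = 0) {V : (Proj 𝒜).Opens}
    {u : twistSections 𝒜 d V} {v : twistSections 𝒜 e V} (h : IsInversePair u v)
    (s : twistSections 𝒜 d V) : twistMul hde s v • u = s := twistSections_ext fun x => by
  rw [twist_smul_apply, twistMul_val, mul_assoc, h.symm x, mul_one]

theorem IsInversePair.twistMul_smul' {d e : ℤ} (hde : d + e = 0) {V : (Proj 𝒜).Opens}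
    {u : twistSections 𝒜 d V} {v : twistSections 𝒜 e V} (h : IsInversePair u v)
    (t : twistSections 𝒜 e V) : twistMul hde u t • v = t := twistSections_ext fun x => by
  rw [twist_smul_apply, twistMul_val, mul_right_comm, h x, one_mul]

theorem IsInversePair.smul_twistMul {d e : ℤ} (hde : d + e = 0) {V : (Proj 𝒜).Opens}
    {u : twistSections 𝒜 d V} {v : twistSections 𝒜 e V} (h : IsInversePair u v)
    (c : Γ(Proj 𝒜, V)) : twistMul hde (c • u) v = c := section_ext fun x => by
  rw [twistMul_val, twist_smul_apply, mul_assoc, h x, mul_one]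

theorem IsInversePair.bijective {d e : ℤ} (hde : d + e = 0) {V : (Proj 𝒜).Opens}
    {u : twistSections 𝒜 d V} {v : twistSections 𝒜 e V} (h : IsInversePair u v)
    (W : (Proj 𝒜).Opens) (hW : W ≤ V) : Function.Bijective fun c : Γ(Proj 𝒜, W) =>
      c • (twist 𝒜 d).presheaf.map (homOfLE hW).op u := by
  refine Function.bijective_iff_has_inverse.mpr
    ⟨fun s : twistSections 𝒜 d W => twistMul hde s (twistRes hW v), fun c => ?_, fun s => ?_⟩
  · exact (h.res hW).smul_twistMul hde c
  · exact (h.res hW).twistMul_smul hde s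

theorem twistToDual_apply {d e : ℤ} (h : d + e = 0) {U : (Proj 𝒜).Opens}
    (s : twistSections 𝒜 d U) (V : {V : (Proj 𝒜).Opens // V ≤ U}) (t : twistSections 𝒜 e V.1) :
    ((twistToDual 𝒜 h).app U s : dualSections (twist 𝒜 e) U).1 V t =
      twistMul h (twistRes V.2 s) t := rfl

/-- Since `t = (u t) v`, linearity gives `φ(t) = (u t) φ(v)`, so `φ` is multiplication by the
section `φ(v) u` of `𝒪(d)`. -/
theorem IsInversePair.bijective_twistToDual {d e : ℤ} (hde : d + e = 0) {V : (Proj 𝒜).Opens}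
    {u : twistSections 𝒜 d V} {v : twistSections 𝒜 e V} (h : IsInversePair u v) :
    Function.Bijective ((twistToDual 𝒜 hde).app V) := by
  refine ⟨fun (s s' : twistSections 𝒜 d V) hs => ?_,
    fun (φ : dualSections (twist 𝒜 e) V) =>
      ⟨HSMul.hSMul (α := Γ(Proj 𝒜, V)) (β := twistSections 𝒜 d V) (φ.1 ⟨V, le_rfl⟩ v) u, ?_⟩⟩
  · have h1 := congrArg (fun φ : dualSections (twist 𝒜 e) V => φ.1 ⟨V, le_rfl⟩ v) hs
    have h2 : twistMul hde s v = twistMul hde s' v := h1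
    rw [← h.twistMul_smul hde s, h2, h.twistMul_smul hde s']
  · refine dualSections_ext fun W (t : twistSections 𝒜 e W.1) => ?_
    refine (twistToDual_apply hde _ W t).trans ?_
    have h1 : (Proj 𝒜).presheaf.map (homOfLE W.2).op (φ.1 ⟨V, le_rfl⟩ v) =
        φ.1 W (twistRes W.2 v : twistSections 𝒜 e W.1) := φ.2 ⟨V, le_rfl⟩ W W.2 v
    refine (twistMul_smul_left hde ((Proj 𝒜).presheaf.map (homOfLE W.2).op (φ.1 ⟨V, le_rfl⟩ v))
      (twistRes W.2 u) t).trans ?_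
    rw [h1]
    refine (mul_comm _ _).trans ((map_smul (φ.1 W) (twistMul hde (twistRes W.2 u) t)
      (twistRes W.2 v : twistSections 𝒜 e W.1)).symm.trans (congrArg (φ.1 W) ?_))
    exact (h.res W.2).twistMul_smul' hde t

/-- A homogeneous element of degree one trivializes `𝒪(1)` and `𝒪(-1)` where it does not vanish. -/
theorem exists_isInversePair_of_mem {f : A} (hf : f ∈ 𝒜 1) :
    ∃ (u : twistSections 𝒜 1 (ProjectiveSpectrum.basicOpen 𝒜 f))
      (v : twistSections 𝒜 (-1) (ProjectiveSpectrum.basicOpen 𝒜 f)), IsInversePair u v := by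
  have hx : ∀ x : ProjectiveSpectrum.basicOpen 𝒜 f, f ∉ x.1.asHomogeneousIdeal := fun x => x.2
  have h1 : ∀ x : ProjectiveSpectrum 𝒜, (1 : A) ∈ x.asHomogeneousIdeal.toIdeal.primeCompl :=
    fun x => one_mem _
  -- The pair is `u = f / 1` and `v = 1 / f`.
  refine ⟨⟨fun x => Localization.mk f 1, fun x => ⟨_, x.2, 𝟙 _, 1, 0, f, 1, fun y => h1 y.1, hf,
      SetLike.one_mem_graded 𝒜, by norm_num, fun y => rfl⟩⟩,
    ⟨fun x => Localization.mk 1 ⟨f, hx x⟩, fun x => ⟨_, x.2, 𝟙 _, 0, 1, 1, f, hx,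
      SetLike.one_mem_graded 𝒜, hf, by norm_num, fun y => rfl⟩⟩, fun x => ?_⟩
  refine (Localization.mk_mul _ _ _ _).trans ?_
  rw [one_mul, mul_one]
  have := x.1.isPrime
  exact Localization.mk_self_mk f (hx x)

end Twist

/-! ### Twisting sheaves on projective space and their direct sums. -/

section ProjSpace

attribute [local instance] Abelian.hasFiniteBiproducts MvPolynomial.gradedAlgebra

variable {n : ℕ} {K : Type u} [Field K]

/-- A point of `Proj` does not contain the irrelevant ideal, and the variables generate that ideal.
-/
theorem exists_X_notMem
    (x : ProjectiveSpectrum (MvPolynomial.homogeneousSubmodule (Fin (n + 1)) K)) :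
    ∃ i, (MvPolynomial.X i : MvPolynomial (Fin (n + 1)) K) ∉ x.asHomogeneousIdeal := by
  by_contra! H
  refine x.not_irrelevant_le ((HomogeneousIdeal.irrelevant_le _).mpr fun d hd z hz => ?_)
  have hz' : z.IsHomogeneous d := hz
  -- A homogeneous polynomial of degree `d > 0` has no constant term, so each of its monomials
  -- involves a variable.
  have hspan : z ∈ Ideal.span (MvPolynomial.X '' (Set.univ : Set (Fin (n + 1)))) := by
    refine MvPolynomial.mem_ideal_span_X_image.mpr fun m hm => ?_
    by_contra! hm0
    have hm1 : m = 0 := Finsupp.ext fun i => hm0 i (Set.mem_univ i)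
    have := hz' (MvPolynomial.mem_support_iff.mp hm)
    rw [hm1, map_zero] at this
    omega
  refine Ideal.span_le.mpr ?_ hspan
  rintro _ ⟨i, -, rfl⟩
  exact H i

theorem exists_isInversePair (x : ProjSpace n K) :
    ∃ (V : (ProjSpace n K).Opens)
      (u : twistSections (MvPolynomial.homogeneousSubmodule (Fin (n + 1)) K) 1 V)
      (v : twistSections (MvPolynomial.homogeneousSubmodule (Fin (n + 1)) K) (-1) V),
      x ∈ V ∧ IsInversePair u v := by
  obtain ⟨i, hi⟩ := exists_X_notMem x
  obtain ⟨u, v, h⟩ := exists_isInversePair_of_mem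
    (𝒜 := MvPolynomial.homogeneousSubmodule (Fin (n + 1)) K) (MvPolynomial.isHomogeneous_X K i)
  exact ⟨_, u, v, hi, h⟩

instance isIso_twistingSheafToDual_one :
    IsIso (twistingSheafToDual n K (add_neg_cancel 1)) :=
  isIso_of_locally_bijective _ fun x => by
    obtain ⟨V, u, v, hx, h⟩ := exists_isInversePair x
    exact ⟨V, hx, fun W hW => (h.res hW).bijective_twistToDual _⟩

instance isIso_twistingSheafToDual_neg_one :
    IsIso (twistingSheafToDual n K (neg_add_cancel 1)) :=
  isIso_of_locally_bijective _ fun x => by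
    obtain ⟨V, u, v, hx, h⟩ := exists_isInversePair x
    exact ⟨V, hx, fun W hW => (h.symm.res hW).bijective_twistToDual _⟩

theorem hasLocalFrames_power_twistingSheaf_one (m : ℕ) :
    HasLocalFrames (power (twistingSheaf n K 1) m) := fun x => by
  obtain ⟨V, u, v, hx, h⟩ := exists_isInversePair x
  exact ⟨V, m, _, hx, isFrame_power m (M := twistingSheaf n K 1) (u := u)
    (h.bijective (add_neg_cancel 1))⟩

instance isIso_powerToDual {X : Scheme.{u}} {L L' : X.Modules} (φ : L ⟶ dual L') [IsIso φ]
    (m : ℕ) : IsIso (powerToDual φ m) := by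
  -- The inverse restricts a functional to the `i`-th summand and applies `φ⁻¹` there.
  refine ⟨biproduct.lift fun i => dualMap (biproduct.ι (fun _ : Fin m => L') i) ≫ inv φ, ?_, ?_⟩
  · refine biproduct.hom_ext' _ _ fun i => biproduct.hom_ext _ _ fun j => ?_
    simp only [powerToDual, biproduct.ι_desc_assoc, Category.assoc, biproduct.lift_π,
      Category.comp_id]
    rw [← Category.assoc (dualMap _), ← dualMap_comp, biproduct.ι_π, biproduct.ι_π]
    by_cases h : j = i
    · subst h
      simp [dualMap_id]
    · rw [dif_neg h, dif_neg (Ne.symm h), dualMap_zero, zero_comp, comp_zero]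
  · rw [powerToDual, biproduct.lift_desc]
    simp only [Category.assoc, IsIso.inv_hom_id_assoc, ← dualMap_comp]
    rw [← dualMap_sum, biproduct.total, dualMap_id]

end ProjSpace

/-! ### Homology of the dual complex. -/

section DualComplex

variable {X : Scheme.{u}}

/-- Replacing the morphism of a kernel fork by an equal one. -/
def isLimitKernelForkOfEq {C : Type*} [Category C] [HasZeroMorphisms C] {A B D : C} {f f' : B ⟶ D}
    (h : f' = f) {i : A ⟶ B} {w : i ≫ f = 0} (hi : IsLimit (KernelFork.ofι i w))
    (w' : i ≫ f' = 0) : IsLimit (KernelFork.ofι i w') := by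
  subst h
  exact hi

theorem mono_dualMap {M N : X.Modules} (f : M ⟶ N) [Epi f] : Mono (dualMap f) := by
  refine ⟨fun {P} g g' h => ?_⟩
  rw [← transpose_transpose g, ← transpose_transpose g']
  congr 1
  rw [← cancel_epi f, ← transpose_comp_dualMap, ← transpose_comp_dualMap, h]

variable (S : ShortComplex X.Modules)

/-- The sequence `0 ⟶ ker g ⟶ X₂ ⟶ X₃ ⟶ 0`. -/
abbrev cyclesComplex : ShortComplex X.Modules := ShortComplex.mk S.iCycles S.g S.iCycles_g

/-- The sequence `0 ⟶ X₁ ⟶ ker g ⟶ H ⟶ 0`. -/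
abbrev homologyComplex : ShortComplex X.Modules :=
  ShortComplex.mk S.toCycles S.homologyπ S.toCycles_comp_homologyπ

theorem shortExact_cyclesComplex [Epi S.g] : (cyclesComplex S).ShortExact where
  exact := ShortComplex.exact_of_f_is_kernel _ S.cyclesIsKernel
  mono_f := inferInstanceAs (Mono S.iCycles)
  epi_g := inferInstanceAs (Epi S.g)

theorem shortExact_homologyComplex [Mono S.f] : (homologyComplex S).ShortExact where
  exact := ShortComplex.exact_of_g_is_cokernel _ S.homologyIsCokernel
  mono_f := by
    have : Mono (S.toCycles ≫ S.iCycles) := by rw [S.toCycles_i]; infer_instance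
    exact mono_of_mono S.toCycles S.iCycles
  epi_g := inferInstanceAs (Epi S.homologyπ)

theorem epi_dualMap_iCycles [Epi S.g] (h₃ : HasLocalFrames S.X₃) : Epi (dualMap S.iCycles) :=
  epi_dualMap_of_shortExact (S := cyclesComplex S) (shortExact_cyclesComplex S) h₃

theorem epi_dualMap_toCycles [Mono S.f] (hH : HasLocalFrames S.homology) :
    Epi (dualMap S.toCycles) :=
  epi_dualMap_of_shortExact (S := homologyComplex S)
    (shortExact_homologyComplex S) hH

/-- Since `f` factors through the cycles, `f^∨` is the composite `X₂^∨ ⟶ Z^∨ ⟶ X₁^∨`. The two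
factors are epimorphisms because `X₃` and the homology, respectively, have local frames. -/
theorem epi_dualMap_f [Mono S.f] [Epi S.g] (h₃ : HasLocalFrames S.X₃)
    (hH : HasLocalFrames S.homology) : Epi (dualMap S.f) := by
  have := epi_dualMap_iCycles S h₃
  have := epi_dualMap_toCycles S hH
  rw [← S.toCycles_i, dualMap_comp]
  exact epi_comp _ _

/-- The homology of the dual complex is the dual of the homology. -/
def dualHomologyData [Mono S.f] [Epi S.g] (h₃ : HasLocalFrames S.X₃) :
    (dualComplex S).RightHomologyData := by
  have hepi := epi_dualMap_iCycles S h₃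
  have wp : dualMap S.g ≫ dualMap S.iCycles = 0 := by
    rw [← dualMap_comp, S.iCycles_g, dualMap_zero]
  -- Left exactness makes `g^∨` the kernel of `iCycles^∨`; as the latter is an epimorphism, it is
  -- the cokernel of `g^∨`. Dualizing thus turns cycles into opcycles, which is why right homology
  -- data are the natural choice.
  have hp : IsColimit (CokernelCofork.ofπ (dualMap S.iCycles) wp) :=
    Abelian.epiIsCokernelOfKernel _ (dualIsKernel _ (shortExact_cyclesComplex S).gIsCokernel)
  have hg : hp.desc (CokernelCofork.ofπ (dualMap S.f) (dualComplex S).zero) =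
      dualMap S.toCycles := by
    refine (cancel_epi (dualMap S.iCycles)).mp ?_
    refine (hp.fac _ WalkingParallelPair.one).trans ?_
    rw [← dualMap_comp, S.toCycles_i]
    rfl
  have hw : dualMap S.homologyπ ≫ dualMap S.toCycles = 0 := by
    rw [← dualMap_comp, S.toCycles_comp_homologyπ, dualMap_zero]
  exact
    { Q := dual S.cycles
      H := dual S.homology
      p := dualMap S.iCycles
      ι := dualMap S.homologyπ
      wp := wp
      hp := hp
      wι := (congrArg (dualMap S.homologyπ ≫ ·) hg).trans hw
      hι := isLimitKernelForkOfEq hg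
        (dualIsKernel _ (shortExact_homologyComplex S).gIsCokernel) _ }

end DualComplex

/-! ### The dual monad and its cohomology. -/

section DualMonad

attribute [local instance] Abelian.hasFiniteBiproducts MvPolynomial.gradedAlgebra

variable {n : ℕ} {K : Type u} [Field K] {r c : ℕ}

/-- The dual of a linear monad whose cohomology has local frames. -/
def LinearMonad.dualMonad (M : LinearMonad n K r c) (hM : HasLocalFrames M.cohomology) :
    LinearMonad n K r c where
  α := powerToDual (twistingSheafToDual n K (neg_add_cancel 1)) c ≫ dualMap M.β ≫
    inv (powerToDual (unitToDual (ProjSpace n K)) (r + 2 * c))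
  β := powerToDual (unitToDual (ProjSpace n K)) (r + 2 * c) ≫ dualMap M.α ≫
    inv (powerToDual (twistingSheafToDual n K (add_neg_cancel 1)) c)
  zero := by
    simp only [Category.assoc, IsIso.inv_hom_id_assoc]
    rw [← Category.assoc (dualMap M.β), ← dualMap_comp, M.zero, dualMap_zero, zero_comp, comp_zero]
  mono_α := by
    have := M.epi_β
    have := mono_dualMap M.β
    infer_instance
  epi_β := by
    have : Mono M.toComplex.f := M.mono_α
    have : Epi M.toComplex.g := M.epi_β
    -- This is where local freeness of the cohomology is needed for the dual to be a monad.
    have : Epi (dualMap M.α) :=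
      epi_dualMap_f M.toComplex (hasLocalFrames_power_twistingSheaf_one c) hM
    infer_instance

/-- The canonical isomorphism from the dual monad to the dual complex. -/
def LinearMonad.dualMonadIso (M : LinearMonad n K r c) (hM : HasLocalFrames M.cohomology) :
    (M.dualMonad hM).toComplex ≅ dualComplex M.toComplex :=
  let e₁ := asIso (powerToDual (twistingSheafToDual n K (neg_add_cancel 1)) c)
  let e₂ := asIso (powerToDual (unitToDual (ProjSpace n K)) (r + 2 * c))
  let e₃ := asIso (powerToDual (twistingSheafToDual n K (add_neg_cancel 1)) c)
  have h₁₂ : e₁.hom ≫ dualMap M.β = (M.dualMonad hM).α ≫ e₂.hom := by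
    simp [e₁, e₂, LinearMonad.dualMonad]
  have h₂₃ : e₂.hom ≫ dualMap M.α = (M.dualMonad hM).β ≫ e₃.hom := by
    simp [e₂, e₃, LinearMonad.dualMonad]
  ShortComplex.isoMk e₁ e₂ e₃ h₁₂ h₂₃

theorem LinearMonad.dualMonad_isDualOf (M : LinearMonad n K r c)
    (hM : HasLocalFrames M.cohomology) : (M.dualMonad hM).IsDualOf M :=
  ⟨M.dualMonadIso hM, rfl, rfl, rfl⟩

/-- The cohomology of the dual monad is the dual of the cohomology. -/
def LinearMonad.dualCohomologyIso (M : LinearMonad n K r c) (hM : HasLocalFrames M.cohomology) :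
    dual M.cohomology ≅ (M.dualMonad hM).cohomology :=
  have : Mono M.toComplex.f := M.mono_α
  have : Epi M.toComplex.g := M.epi_β
  (dualHomologyData M.toComplex (hasLocalFrames_power_twistingSheaf_one c)).homologyIso.symm ≪≫
    (ShortComplex.homologyMapIso (M.dualMonadIso hM)).symm

end DualMonad

end
end Instanton


theorem mainTheorem11 (K : Type u) [Field K] [IsAlgClosed K] [CharZero K] (n r c : ℕ)
    (E : (Instanton.ProjSpace n K).Modules) (hE : Instanton.IsInstantonBundle r c E) :
    (∀ M : Instanton.LinearMonad n K r c, Nonempty (E ≅ M.cohomology) →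
      ∃ M' : Instanton.LinearMonad n K r c,
        M'.IsDualOf M ∧ Nonempty (Instanton.dual E ≅ M'.cohomology)) ∧
    Instanton.IsInstantonBundle r c (Instanton.dual E) := by
  have hfr := Instanton.isLocallyFree_iff_hasLocalFrames.mp hE.2
  have key : ∀ M : Instanton.LinearMonad n K r c, Nonempty (E ≅ M.cohomology) →
      ∃ M' : Instanton.LinearMonad n K r c,
        M'.IsDualOf M ∧ Nonempty (Instanton.dual E ≅ M'.cohomology) := by
    rintro M ⟨i⟩
    have hM := hfr.of_iso i
    exact ⟨M.dualMonad hM, M.dualMonad_isDualOf hM,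
      ⟨Instanton.dualIso i.symm ≪≫ M.dualCohomologyIso hM⟩⟩
  refine ⟨key, ?_, Instanton.isLocallyFree_iff_hasLocalFrames.mpr hfr.dual⟩
  obtain ⟨M, hM⟩ := hE.1
  obtain ⟨M', -, h⟩ := key M hM
  exact ⟨M', h⟩
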